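/- Define $F\colon[0,\infty)\to\mathbb R$ by $F(r)=\int_0^r\frac{du}{-\log u}$ for $0\le r\le e^{-2}$ and $F(r)=F(e^{-2})+\tfrac12(r-e^{-2})$ for $r\ge e^{-2}$. For $a,\varepsilon>0$ put \[ f_{\varepsilon,a}(x_1,x_2)=F\bigl(\sqrt{x_1^2+x_2^2}\bigr)+\tfrac{\varepsilon}{2}\bigl(\max\{x_1-a,0\}\bigr)^2,\qquad (x_1,x_2)\in\mathbb R^2 . \] A solution of the Nesterov flow for $f_{\varepsilon,a}$ is a map $X=(X_1,X_2)\colon[0,\infty)\to\mathbb R^2$, $C^1$ on $[0,\infty)$ and $C^2$ on $(0,\infty)$, with \[ \ddot X(t)+\tfrac3t\dot X(t)+\nabla f_{\varepsilon,a}(X(t))=0\quad(t>0),\qquad X(0)=(2a,a),\qquad \dot X(0)=0 . \] For such $X$ put $T_{\mathrm{rad}}=\sup\{t\ge0:\|X(t)\|>a\}$ and \[ \kappa_\varepsilon=\varepsilon\int_0^{T_{\mathrm{rad}}}s^3X_2(s)\max\{X_1(s)-a,0\}\,ds . \] Theorem. Let $a>0$. (i) There is $\varepsilon_0>0$ such that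 for every $\varepsilon\in(0,\varepsilon_0)$ a solution exists, and every solution satisfies $\kappa_\varepsilon>0$. (ii) For every $\varepsilon>0$ and every solution $X$ with $\kappa_\varepsilon>0$ there are constants $c_0,C_0>0$ and $T_0>1$ such that \[ \frac{c_0}{t^2\log t}\le f_{\varepsilon,a}(X(t))\le\frac{C_0}{t^2}\qquad\text{for all }t\ge T_0 . \] -/

import Mathlib

open Set MeasureTheory

noncomputable section

namespace NesterovFlow

/-- The Euclidean plane. -/
abbrev Plane : Type := EuclideanSpace ℝ (Fin 2)

/-- The radial profile `F` on `[0, ∞)`: the integral of `1 / (-log u)` over `[0, r]` for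
`r ≤ e⁻²`, continued with constant slope `1/2` for `r ≥ e⁻²`.  It is only evaluated at `r ≥ 0`. -/
def radialProfile (r : ℝ) : ℝ :=
  if r ≤ Real.exp (-2) then ∫ u in (0 : ℝ)..r, 1 / (-Real.log u)
  else (∫ u in (0 : ℝ)..Real.exp (-2), 1 / (-Real.log u)) + (1 / 2) * (r - Real.exp (-2))

/-- The one-sided quadratic `Ψ_a(u) = (1/2) (u - a)₊²`. -/
def oneSidedQuadratic (a u : ℝ) : ℝ := (1 / 2) * (max (u - a) 0) ^ 2

/-- The potential `f_{ε,a}(x) = F(‖x‖) + ε Ψ_a(x₁)` on the plane. -/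
def potential (ε a : ℝ) (x : Plane) : ℝ :=
  radialProfile ‖x‖ + ε * oneSidedQuadratic a (x 0)

/-- `X`, restricted to `[0, ∞)`, is a global solution of the critical Nesterov flow
`X'' + (3/t) X' + ∇f(X) = 0` for `t > 0`, with `X(0) = X₀` and `X'(0) = 0`.
It is `C¹` on `[0, ∞)` and `C²` on `(0, ∞)`; the derivative at `0` is one-sided. -/
structure IsSolution (f : Plane → ℝ) (X₀ : Plane) (X : ℝ → Plane) : Prop where
  contDiffOn_one : ContDiffOn ℝ 1 X (Ici 0)
  contDiffOn_two : ContDiffOn ℝ 2 X (Ioi 0)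
  initial_position : X 0 = X₀
  initial_velocity : derivWithin X (Ici 0) 0 = 0
  ode : ∀ t : ℝ, 0 < t → deriv (deriv X) t + (3 / t) • deriv X t + gradient f (X t) = 0

/-- The starting point `(2a, a)`. -/
def startPoint (a : ℝ) : Plane := !₂[2 * a, a]

/-- The time `T_rad = sup {t ≥ 0 : ‖X(t)‖ > a}`. -/
def radialTime (a : ℝ) (X : ℝ → Plane) : ℝ := sSup {t : ℝ | 0 ≤ t ∧ a < ‖X t‖}

/-- The constant `κ_ε = ε ∫₀^{T_rad} s³ X₂(s) (X₁(s) - a)₊ ds`. -/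
def angularConstant (ε a : ℝ) (X : ℝ → Plane) : ℝ :=
  ε * ∫ s in (0 : ℝ)..radialTime a X, s ^ 3 * X s 1 * max (X s 0 - a) 0

end NesterovFlow

end

/-! Write $r=\|X\|$ and $L=X_1\dot X_2-X_2\dot X_1$, and let $P$ be the potential along the motion.
Since $F(r)\le rF'(r)$, and similarly for the one-sided quadratic, the function $t^2P+2\|X+\tfrac
t2\dot X\|^2$ is nonincreasing from the value $10a^2$ (`lyapunov_le`). This gives the upper bound,
and it confines the motion to $r\le a$ after a fixed time. The radial force exerts no torque, so
$(t^3L)'=\varepsilon t^3X_2\max\{X_1-a,0\}$, which vanishes once $r\le a$; from then on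
$t^3L=\kappa_\varepsilon$. With $\|\dot X\|\le 7a/t$, a positive $\kappa_\varepsilon$ forces
$r\gtrsim t^{-2}$, and $F(r)\ge\tfrac r2F'(\tfrac r2)$ turns this into the lower bound with its
logarithm (`potential_bounds`). For $\varepsilon=0$ the motion should stay on the line $x=2y$, where
the torque is nonnegative. $F'(r)/r$ is unbounded at the origin, so a Gronwall estimate is
unavailable. Instead the squared deviation from the line in phase space is divided by the squared
phase-space norm: every term in the derivative of this quotient carries a factor $L$ or
$\varepsilon$, and $|L|F'(r)/r$ is small even near the origin (`abs_moment_mul_le`). The norm stays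
away from $0$ because $t^6$ times the energy is nondecreasing. This yields $\kappa_\varepsilon>0$
for every solution, without uniqueness. Existence is a Peano argument with delayed forces and
Arzelà–Ascoli (`exists_eq_response`). -/

noncomputable section

namespace NesterovFlow

open Filter Topology

/-! ### The radial profile -/

/-- The derivative of the radial profile, extended by `0` to the negative half-line. -/
def slope (r : ℝ) : ℝ := (-Real.log (min (max r 0) (Real.exp (-2))))⁻¹

theorem slope_of_nonpos {r : ℝ} (hr : r ≤ 0) : slope r = 0 := by
  simp [slope, max_eq_right hr, (Real.exp_pos (-2)).le]

theorem slope_of_mem {r : ℝ} (h0 : 0 ≤ r) (h1 : r ≤ Real.exp (-2)) :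
    slope r = (-Real.log r)⁻¹ := by
  rw [slope, max_eq_left h0, min_eq_left h1]

theorem slope_of_ge {r : ℝ} (h1 : Real.exp (-2) ≤ r) : slope r = 1 / 2 := by
  rw [slope, max_eq_left ((Real.exp_pos _).le.trans h1), min_eq_right h1, Real.log_exp]
  norm_num

theorem two_le_neg_log {r : ℝ} (hr : 0 < r) : 2 ≤ -Real.log (min (max r 0) (Real.exp (-2))) := by
  have h : Real.log (min (max r 0) (Real.exp (-2))) ≤ Real.log (Real.exp (-2)) :=
    Real.log_le_log (lt_min (lt_max_of_lt_left hr) (Real.exp_pos _)) (min_le_right _ _)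
  rw [Real.log_exp] at h
  linarith

theorem slope_pos {r : ℝ} (hr : 0 < r) : 0 < slope r :=
  inv_pos.2 (by linarith [two_le_neg_log hr])

theorem slope_nonneg (r : ℝ) : 0 ≤ slope r := by
  rcases le_or_gt r 0 with hr | hr
  · rw [slope_of_nonpos hr]
  · exact (slope_pos hr).le

theorem slope_le_half (r : ℝ) : slope r ≤ 1 / 2 := by
  rcases le_or_gt r 0 with hr | hr
  · rw [slope_of_nonpos hr]; norm_num
  · rw [slope, one_div]
    exact inv_anti₀ two_pos (two_le_neg_log hr)

theorem slope_monotone : Monotone slope := by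
  intro r s hrs
  rcases le_or_gt r 0 with hr | hr
  · rw [slope_of_nonpos hr]; exact slope_nonneg s
  · refine inv_anti₀ (by linarith [two_le_neg_log (hr.trans_le hrs)]) (neg_le_neg ?_)
    exact Real.log_le_log (lt_min (lt_max_of_lt_left hr) (Real.exp_pos _))
      (min_le_min_right _ (max_le_max_right _ hrs))

theorem slope_continuous : Continuous slope := by
  have key : ∀ s : ℝ, s ≤ Real.exp (-2) → 0 ≤ s →
      ContinuousAt (fun u : ℝ => (-Real.log u)⁻¹) s := by
    intro s hs h0
    rcases h0.eq_or_lt with rfl | h0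
    -- At $0$ the conventions `Real.log 0 = 0` and `0⁻¹ = 0` give the value $0$, which is the true
    -- limit of $1/(-\log u)$.
    · rw [continuousAt_iff_punctured_nhds]
      rw [Real.log_zero, neg_zero, inv_zero]
      exact tendsto_inv_atTop_zero.comp
        (tendsto_neg_atBot_atTop.comp Real.tendsto_log_nhdsNE_zero)
    · refine ((Real.continuousAt_log h0.ne').neg).inv₀ ?_
      have := Real.log_le_log h0 hs
      rw [Real.log_exp] at this
      simp only [Pi.neg_apply]
      linarith
  refine continuous_iff_continuousAt.2 fun r => ?_
  exact ContinuousAt.comp (f := fun r : ℝ => min (max r 0) (Real.exp (-2)))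
    (key _ (min_le_right _ _) (le_min (le_max_right _ _) (Real.exp_pos _).le))
    (by fun_prop)

/-- The radial profile, extended by `0` to the negative half-line. -/
def profile (r : ℝ) : ℝ := ∫ u in (0 : ℝ)..r, slope u

theorem slope_intervalIntegrable (b c : ℝ) : IntervalIntegrable slope volume b c :=
  slope_continuous.intervalIntegrable b c

theorem profile_sub (b c : ℝ) : profile c - profile b = ∫ u in b..c, slope u :=
  intervalIntegral.integral_interval_sub_left (slope_intervalIntegrable _ _)
    (slope_intervalIntegrable _ _)

theorem radialProfile_eq {r : ℝ} (hr : 0 ≤ r) : radialProfile r = profile r := by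
  have key : ∀ s : ℝ, 0 ≤ s → s ≤ Real.exp (-2) →
      ∫ u in (0 : ℝ)..s, 1 / (-Real.log u) = profile s := by
    intro s h0 h1
    refine intervalIntegral.integral_congr fun u hu => ?_
    rw [uIcc_of_le h0] at hu
    simp only [one_div, slope_of_mem hu.1 (hu.2.trans h1)]
  unfold radialProfile
  split_ifs with h
  · exact key r hr h
  · rw [key _ (Real.exp_pos _).le le_rfl]
    have h1 : profile r - profile (Real.exp (-2)) = ∫ _u in Real.exp (-2)..r, (1 / 2 : ℝ) := by
      rw [profile_sub]
      refine intervalIntegral.integral_congr fun u hu => ?_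
      rw [uIcc_of_le (not_le.1 h).le] at hu
      exact slope_of_ge hu.1
    rw [intervalIntegral.integral_const, smul_eq_mul] at h1
    linarith

theorem profile_zero : profile 0 = 0 := intervalIntegral.integral_same

theorem hasDerivAt_profile (r : ℝ) : HasDerivAt profile (slope r) r :=
  intervalIntegral.integral_hasDerivAt_right (slope_intervalIntegrable _ _)
    (slope_continuous.stronglyMeasurableAtFilter _ _) slope_continuous.continuousAt

theorem profile_monotone : Monotone profile := fun b c hbc => by
  have := intervalIntegral.integral_nonneg (μ := volume) hbc fun u _ => slope_nonneg u
  rw [← profile_sub] at this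
  linarith

theorem profile_nonneg {r : ℝ} (hr : 0 ≤ r) : 0 ≤ profile r := by
  simpa [profile_zero] using profile_monotone hr

theorem profile_sub_le {b c : ℝ} (hbc : b ≤ c) : profile c - profile b ≤ (c - b) * slope c := by
  rw [profile_sub, ← smul_eq_mul, ← intervalIntegral.integral_const]
  exact intervalIntegral.integral_mono_on hbc (slope_intervalIntegrable _ _)
    (by simp) fun u hu => slope_monotone hu.2

theorem le_profile_sub {b c : ℝ} (hbc : b ≤ c) : (c - b) * slope b ≤ profile c - profile b := by
  rw [profile_sub, ← smul_eq_mul, ← intervalIntegral.integral_const]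
  exact intervalIntegral.integral_mono_on hbc (by simp) (slope_intervalIntegrable _ _)
    fun u hu => slope_monotone hu.1

theorem profile_le_mul_slope {r : ℝ} (hr : 0 ≤ r) : profile r ≤ r * slope r := by
  simpa [profile_zero] using profile_sub_le hr

theorem profile_le_half {r : ℝ} (hr : 0 ≤ r) : profile r ≤ r / 2 := by
  have := profile_le_mul_slope hr
  nlinarith [slope_le_half r]

theorem half_mul_slope_le_profile {r : ℝ} (hr : 0 ≤ r) : r / 2 * slope (r / 2) ≤ profile r := by
  have h := le_profile_sub (half_le_self hr)
  have h' := profile_nonneg (show 0 ≤ r / 2 by positivity)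
  linarith

/-- Coercivity: the slope is $1/2$ beyond $1>e^{-2}$. An energy bound thus bounds the distance to
the origin. -/
theorem half_sub_one_le_profile {r : ℝ} (hr : 0 ≤ r) : (r - 1) / 2 ≤ profile r := by
  rcases le_or_gt r 1 with h | h
  · linarith [profile_nonneg hr]
  · have h1 := le_profile_sub h.le
    rw [slope_of_ge (Real.exp_le_one_iff.2 (by norm_num))] at h1
    linarith [profile_nonneg zero_le_one]

theorem profile_pos {r : ℝ} (hr : 0 < r) : 0 < profile r :=
  (mul_pos (half_pos hr) (slope_pos (half_pos hr))).trans_le (half_mul_slope_le_profile hr.le)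

/-! ### The gradient of the potential -/

/-- The norm is not differentiable at the origin, but $F'(0)=0$ makes $F(\|z\|)=o(\|z\|)$ there; the
coefficient `slope ‖x‖ / ‖x‖` is then `0 / 0 = 0`. -/
theorem hasFDerivAt_profile_norm {E : Type*} [NormedAddCommGroup E] [InnerProductSpace ℝ E]
    (x : E) :
    HasFDerivAt (fun z : E => profile ‖z‖) ((slope ‖x‖ / ‖x‖) • innerSL ℝ x) x := by
  rcases eq_or_ne x 0 with rfl | hx
  · have h0 : (slope ‖(0 : E)‖ / ‖(0 : E)‖) • innerSL ℝ (0 : E) = 0 := by simp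
    rw [h0, hasFDerivAt_iff_isLittleO_nhds_zero]
    have h := (hasDerivAt_iff_isLittleO_nhds_zero.1 (hasDerivAt_profile 0)).comp_tendsto
      (tendsto_norm_zero (E := E))
    refine (h.congr_left fun z => ?_).of_norm_right
    simp [slope_of_nonpos, profile_zero]
  · have hsq := (hasStrictFDerivAt_norm_sq x).hasFDerivAt.sqrt (by positivity)
    have hn : HasFDerivAt (fun z : E => ‖z‖) ((1 / ‖x‖) • innerSL ℝ x) x := by
      convert hsq using 1
      · ext z; simp
      · ext z
        simp
        ring
    have := (hasDerivAt_profile ‖x‖).comp_hasFDerivAt x hn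
    rwa [smul_smul, mul_one_div] at this

theorem hasDerivAt_oneSidedQuadratic (a u : ℝ) :
    HasDerivAt (oneSidedQuadratic a) (max (u - a) 0) u := by
  have key : HasDerivAt (fun v : ℝ => (max v 0) ^ 2) (2 * max (u - a) 0) (u - a) := by
    rcases lt_trichotomy (u - a) 0 with h | h | h
    · rw [max_eq_right h.le]
      refine (hasDerivAt_const (u - a) (0 : ℝ)).congr_of_eventuallyEq ?_ |>.congr_deriv (by simp)
      filter_upwards [Iio_mem_nhds h] with v hv
      simp [max_eq_right (mem_Iio.1 hv).le]
    · rw [h, max_self, mul_zero, hasDerivAt_iff_isLittleO_nhds_zero]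
      have h2 : (fun v : ℝ => v ^ 2) =o[𝓝 0] fun v : ℝ => v := by
        simpa using Asymptotics.isLittleO_pow_pow (𝕜 := ℝ) (m := 1) (n := 2) (by norm_num)
      refine Asymptotics.IsBigO.trans_isLittleO (Asymptotics.IsBigO.of_bound 1 ?_) h2
      refine Eventually.of_forall fun v => ?_
      simp only [zero_add, max_self, smul_zero, sub_zero, norm_pow, one_mul]
      simp only [ne_eq, OfNat.ofNat_ne_zero, not_false_eq_true, zero_pow, sub_zero, norm_pow]
      refine pow_le_pow_left₀ (norm_nonneg _) ?_ 2
      rw [Real.norm_eq_abs, Real.norm_eq_abs, abs_of_nonneg (le_max_right _ _)]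
      exact max_le (le_abs_self v) (abs_nonneg v)
    · rw [max_eq_left h.le]
      have h1 : HasDerivAt (fun v : ℝ => v ^ 2) (2 * (u - a)) (u - a) := by
        simpa using hasDerivAt_pow 2 (u - a)
      refine h1.congr_of_eventuallyEq ?_
      filter_upwards [Ioi_mem_nhds h] with v hv
      simp [max_eq_left (mem_Ioi.1 hv).le]
  have := (key.comp u ((hasDerivAt_id u).sub_const a)).const_mul (1 / 2 : ℝ)
  exact this.congr_deriv (by ring)

/-- The gradient of the potential. -/
def force (ε a : ℝ) (x : Plane) : Plane :=
  (slope ‖x‖ / ‖x‖) • x + (ε * max (x 0 - a) 0) • EuclideanSpace.single 0 1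

theorem potential_eq (ε a : ℝ) (x : Plane) :
    potential ε a x = profile ‖x‖ + ε * oneSidedQuadratic a (x 0) := by
  rw [potential, radialProfile_eq (norm_nonneg x)]

theorem hasGradientAt_potential (ε a : ℝ) (x : Plane) :
    HasGradientAt (potential ε a) (force ε a x) x := by
  rw [hasGradientAt_iff_hasFDerivAt]
  have h1 := hasFDerivAt_profile_norm x
  have h2 := (hasDerivAt_oneSidedQuadratic a (x 0)).comp_hasFDerivAt x
    (EuclideanSpace.proj (𝕜 := ℝ) (0 : Fin 2)).hasFDerivAt
  have h3 := h1.add (h2.const_mul ε)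
  have hfun : potential ε a = (fun z : Plane => profile ‖z‖) +
      fun z : Plane => ε * (oneSidedQuadratic a ∘ ⇑(EuclideanSpace.proj (𝕜 := ℝ) (0 : Fin 2))) z := by
    ext z
    simp [potential_eq]
  rw [hfun]
  refine h3.congr_fderiv ?_
  ext z
  simp [force, EuclideanSpace.inner_single_left]
  ring

/-! ### Solutions in coordinates -/

/-- A solution of the flow written in coordinates: position `(x, y)`, velocity `(u, v)`,
distance `r` to the origin and potential `P` along the trajectory. -/
structure PlanarMotion (ε a : ℝ) (x y u v r P : ℝ → ℝ) : Prop where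
  continuousOn_x : ContinuousOn x (Ici 0)
  continuousOn_y : ContinuousOn y (Ici 0)
  continuousOn_u : ContinuousOn u (Ici 0)
  continuousOn_v : ContinuousOn v (Ici 0)
  continuousOn_P : ContinuousOn P (Ici 0)
  x_zero : x 0 = 2 * a
  y_zero : y 0 = a
  u_zero : u 0 = 0
  v_zero : v 0 = 0
  r_nonneg : ∀ t, 0 ≤ r t
  r_sq : ∀ t, r t ^ 2 = x t ^ 2 + y t ^ 2
  P_eq : ∀ t, P t = profile (r t) + ε * (1 / 2 * max (x t - a) 0 ^ 2)
  deriv_x : ∀ t, 0 < t → HasDerivAt x (u t) t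
  deriv_y : ∀ t, 0 < t → HasDerivAt y (v t) t
  deriv_u : ∀ t, 0 < t → HasDerivAt u
    (-(3 / t * u t) - (slope (r t) / r t * x t + ε * max (x t - a) 0)) t
  deriv_v : ∀ t, 0 < t → HasDerivAt v (-(3 / t * v t) - slope (r t) / r t * y t) t
  deriv_P : ∀ t, 0 < t → HasDerivAt P
    ((slope (r t) / r t * x t + ε * max (x t - a) 0) * u t + slope (r t) / r t * y t * v t) t

/-- The velocity is the one-sided `derivWithin`: it is continuous up to $t=0$ and insensitive to the
values of $X$ at negative times. -/
theorem IsSolution.planarMotion {ε a : ℝ} {X : ℝ → Plane}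
    (h : IsSolution (potential ε a) (startPoint a) X) :
    PlanarMotion ε a (fun t => X t 0) (fun t => X t 1)
      (fun t => derivWithin X (Ici 0) t 0) (fun t => derivWithin X (Ici 0) t 1)
      (fun t => ‖X t‖) (fun t => potential ε a (X t)) := by
  have hX : ContinuousOn X (Ici 0) := h.contDiffOn_one.continuousOn
  have hV : ContinuousOn (derivWithin X (Ici 0)) (Ici 0) :=
    h.contDiffOn_one.continuousOn_derivWithin (uniqueDiffOn_Ici 0) le_rfl
  have hcoord : ∀ i : Fin 2, Continuous fun z : Plane => z i := fun i => by fun_prop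
  have hpot : Continuous (potential ε a) :=
    continuous_iff_continuousAt.2 fun z => (hasGradientAt_potential ε a z).continuousAt
  have hdX : ∀ t, 0 < t → HasDerivAt X (derivWithin X (Ici 0) t) t := fun t ht =>
    ((h.contDiffOn_one.differentiableOn one_ne_zero t ht.le).hasDerivWithinAt).hasDerivAt
      (Ici_mem_nhds ht)
  have hdV : ∀ t, 0 < t → HasDerivAt (derivWithin X (Ici 0))
      (-((3 / t) • derivWithin X (Ici 0) t) - force ε a (X t)) t := by
    intro t ht
    have hC : ContDiffOn ℝ 1 (deriv X) (Ioi 0) :=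
      h.contDiffOn_two.deriv_of_isOpen isOpen_Ioi (by norm_num)
    have h1 : HasDerivAt (deriv X) (deriv (deriv X) t) t :=
      ((hC.differentiableOn one_ne_zero).differentiableAt (Ioi_mem_nhds ht)).hasDerivAt
    have h2 : deriv (deriv X) t = -((3 / t) • derivWithin X (Ici 0) t) - force ε a (X t) := by
      have h3 := h.ode t ht
      rw [(hasGradientAt_potential ε a (X t)).gradient, (hdX t ht).deriv] at h3
      rw [← sub_eq_zero, ← h3]
      abel
    rw [← h2]
    refine h1.congr_of_eventuallyEq ?_
    filter_upwards [Ioi_mem_nhds ht] with s hs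
    exact (hdX s hs).deriv.symm
  have hproj : ∀ (Y : ℝ → Plane) (Y' : Plane) (t : ℝ) (i : Fin 2), HasDerivAt Y Y' t →
      HasDerivAt (fun s => Y s i) (Y' i) t := fun Y Y' t i hY =>
    (EuclideanSpace.proj (𝕜 := ℝ) i).hasFDerivAt.comp_hasDerivAt t hY
  constructor
  · exact (hcoord 0).comp_continuousOn hX
  · exact (hcoord 1).comp_continuousOn hX
  · exact (hcoord 0).comp_continuousOn hV
  · exact (hcoord 1).comp_continuousOn hV
  · exact hpot.comp_continuousOn hX
  · simp [h.initial_position, startPoint]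
  · simp [h.initial_position, startPoint]
  · simp [h.initial_velocity]
  · simp [h.initial_velocity]
  · exact fun t => norm_nonneg _
  · intro t
    simp [EuclideanSpace.norm_sq_eq, Fin.sum_univ_two]
  · exact fun t => potential_eq ε a (X t)
  · exact fun t ht => hproj _ _ t 0 (hdX t ht)
  · exact fun t ht => hproj _ _ t 1 (hdX t ht)
  · intro t ht
    refine (hproj _ _ t 0 (hdV t ht)).congr_deriv ?_
    simp [force]
  · intro t ht
    refine (hproj _ _ t 1 (hdV t ht)).congr_deriv ?_
    simp [force]
  · intro t ht
    have h1 := (hasGradientAt_potential ε a (X t)).hasFDerivAt.comp_hasDerivAt t (hdX t ht)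
    refine h1.congr_deriv ?_
    simp [force, PiLp.inner_apply, Fin.sum_univ_two]
    ring

/-! ### Energy, Lyapunov function and angular momentum -/

theorem apply_le_of_deriv_nonpos {h h' : ℝ → ℝ} (hc : ContinuousOn h (Ici 0))
    (hd : ∀ t, 0 < t → HasDerivAt h (h' t) t) (hn : ∀ t, 0 < t → h' t ≤ 0) {s t : ℝ}
    (hs : 0 ≤ s) (hst : s ≤ t) : h t ≤ h s := by
  refine antitoneOn_of_deriv_nonpos (convex_Ici 0) hc ?_ ?_ hs (hs.trans hst) hst
  · rw [interior_Ici]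
    exact fun τ hτ => (hd τ hτ).differentiableAt.differentiableWithinAt
  · rw [interior_Ici]
    exact fun τ hτ => (hd τ hτ).deriv.trans_le (hn τ hτ)

theorem apply_le_of_deriv_nonneg {h h' : ℝ → ℝ} (hc : ContinuousOn h (Ici 0))
    (hd : ∀ t, 0 < t → HasDerivAt h (h' t) t) (hn : ∀ t, 0 < t → 0 ≤ h' t) {s t : ℝ}
    (hs : 0 ≤ s) (hst : s ≤ t) : h s ≤ h t :=
  neg_le_neg_iff.1 (apply_le_of_deriv_nonpos (h := -h) (h' := -h') hc.neg
    (fun τ hτ => (hd τ hτ).neg) (fun τ hτ => neg_nonpos.2 (hn τ hτ)) hs hst)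

namespace PlanarMotion

variable {ε a : ℝ} {x y u v r P : ℝ → ℝ}

theorem r_zero_sq (h : PlanarMotion ε a x y u v r P) : r 0 ^ 2 = 5 * a ^ 2 := by
  rw [h.r_sq, h.x_zero, h.y_zero]; ring

theorem abs_x_le (h : PlanarMotion ε a x y u v r P) (t : ℝ) : |x t| ≤ r t :=
  abs_le_of_sq_le_sq (by nlinarith [h.r_sq t, sq_nonneg (y t)]) (h.r_nonneg t)

theorem abs_y_le (h : PlanarMotion ε a x y u v r P) (t : ℝ) : |y t| ≤ r t :=
  abs_le_of_sq_le_sq (by nlinarith [h.r_sq t, sq_nonneg (x t)]) (h.r_nonneg t)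

theorem profile_le_P (h : PlanarMotion ε a x y u v r P) (hε : 0 < ε) (t : ℝ) :
    profile (r t) ≤ P t := by
  rw [h.P_eq]
  have : 0 ≤ ε * (1 / 2 * max (x t - a) 0 ^ 2) := by positivity
  linarith

theorem P_nonneg (h : PlanarMotion ε a x y u v r P) (hε : 0 < ε) (t : ℝ) : 0 ≤ P t :=
  (profile_nonneg (h.r_nonneg t)).trans (h.profile_le_P hε t)

theorem continuousOn_r (h : PlanarMotion ε a x y u v r P) : ContinuousOn r (Ici 0) := by
  have h1 : r = fun t => √(x t ^ 2 + y t ^ 2) := by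
    ext t
    rw [← h.r_sq, Real.sqrt_sq (h.r_nonneg t)]
  rw [h1]
  exact ((h.continuousOn_x.pow 2).add (h.continuousOn_y.pow 2)).sqrt

/-- Friction dissipates the mechanical energy. -/
theorem deriv_energy (h : PlanarMotion ε a x y u v r P) {t : ℝ} (ht : 0 < t) :
    HasDerivAt (fun s => (u s ^ 2 + v s ^ 2) / 2 + P s) (-(3 / t) * (u t ^ 2 + v t ^ 2)) t := by
  have h1 := ((((h.deriv_u t ht).pow 2).add ((h.deriv_v t ht).pow 2)).div_const 2).add
    (h.deriv_P t ht)
  refine h1.congr_deriv ?_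
  simp only [Nat.cast_ofNat, Nat.add_one_sub_one, pow_one]
  ring

theorem continuousOn_energy (h : PlanarMotion ε a x y u v r P) :
    ContinuousOn (fun s => (u s ^ 2 + v s ^ 2) / 2 + P s) (Ici 0) :=
  (((h.continuousOn_u.pow 2).add (h.continuousOn_v.pow 2)).div_const 2).add h.continuousOn_P

theorem energy_le (h : PlanarMotion ε a x y u v r P) {t : ℝ} (ht : 0 ≤ t) :
    (u t ^ 2 + v t ^ 2) / 2 + P t ≤ P 0 := by
  have := apply_le_of_deriv_nonpos h.continuousOn_energy (fun τ hτ => h.deriv_energy hτ)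
    (fun τ hτ => by
      have : 0 ≤ 3 / τ * (u τ ^ 2 + v τ ^ 2) := by positivity
      linarith) le_rfl ht
  simpa [h.u_zero, h.v_zero] using this

/-- Friction drains energy at rate at most $6/t$, only the kinetic part being affected: the
derivative of $t^6E$ is $6t^5P\ge0$. -/
theorem energy_growth (h : PlanarMotion ε a x y u v r P) (hε : 0 < ε) {s t : ℝ} (hs : 0 ≤ s)
    (hst : s ≤ t) : s ^ 6 * ((u s ^ 2 + v s ^ 2) / 2 + P s) ≤
      t ^ 6 * ((u t ^ 2 + v t ^ 2) / 2 + P t) := by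
  refine apply_le_of_deriv_nonneg (h := fun s => s ^ 6 * ((u s ^ 2 + v s ^ 2) / 2 + P s))
    ((continuousOn_id.pow 6).mul h.continuousOn_energy)
    (fun τ hτ => (hasDerivAt_pow 6 τ).mul (h.deriv_energy hτ)) (fun τ hτ => ?_) hs hst
  have h1 := h.P_nonneg hε τ
  have h2 : (6 : ℕ) * τ ^ (6 - 1) * ((u τ ^ 2 + v τ ^ 2) / 2 + P τ) +
      τ ^ 6 * (-(3 / τ) * (u τ ^ 2 + v τ ^ 2)) = 6 * τ ^ 5 * P τ := by
    field_simp
    norm_num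
    ring
  rw [h2]
  positivity

theorem r_le (h : PlanarMotion ε a x y u v r P) (hε : 0 < ε) {t : ℝ} (ht : 0 ≤ t) :
    r t ≤ 2 * P 0 + 1 := by
  have h1 := h.energy_le ht
  have h2 := half_sub_one_le_profile (h.r_nonneg t)
  have h3 := h.profile_le_P hε t
  nlinarith [sq_nonneg (u t), sq_nonneg (v t)]

theorem speed_sq_le (h : PlanarMotion ε a x y u v r P) (hε : 0 < ε) {t : ℝ} (ht : 0 ≤ t) :
    u t ^ 2 + v t ^ 2 ≤ 2 * P 0 := by
  linarith [h.energy_le ht, h.P_nonneg hε t]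

/-- The inequality $\Psi_a(z)\le z\,\Psi_a'(z)$, the counterpart of `profile_le_mul_slope` for the
second summand of the potential. -/
theorem half_sq_le_max_mul (ha : 0 < a) (z : ℝ) :
    1 / 2 * max (z - a) 0 ^ 2 ≤ max (z - a) 0 * z := by
  rcases le_total (z - a) 0 with hx | hx
  · simp [max_eq_right hx]
  · rw [max_eq_left hx]
    nlinarith

/-- The derivative is $2t\,(f(X)-\langle\nabla f(X),X\rangle)$, nonpositive by convexity with
minimum $f(0)=0$. The initial value is $2\|X(0)\|^2=10a^2$. -/
theorem lyapunov_le (h : PlanarMotion ε a x y u v r P) (ha : 0 < a) (hε : 0 < ε) {t : ℝ}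
    (ht : 0 ≤ t) :
    t ^ 2 * P t + 2 * ((x t + t / 2 * u t) ^ 2 + (y t + t / 2 * v t) ^ 2) ≤ 10 * a ^ 2 := by
  have hd : ∀ τ, 0 < τ → HasDerivAt
      (fun t => t ^ 2 * P t + 2 * ((x t + t / 2 * u t) ^ 2 + (y t + t / 2 * v t) ^ 2))
      (2 * τ * (P τ - slope (r τ) / r τ * r τ ^ 2 - ε * (max (x τ - a) 0 * x τ))) τ := by
    intro τ hτ
    have h0 := (hasDerivAt_id τ).div_const 2
    have h1 := ((hasDerivAt_pow 2 τ).mul (h.deriv_P τ hτ)).add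
      (((((h.deriv_x τ hτ).add (h0.mul (h.deriv_u τ hτ))).pow 2).add
        (((h.deriv_y τ hτ).add (h0.mul (h.deriv_v τ hτ))).pow 2)).const_mul 2)
    refine h1.congr_deriv ?_
    rw [h.r_sq]
    simp only [Nat.cast_ofNat, Nat.add_one_sub_one, pow_one, Pi.add_apply, Pi.mul_apply, id]
    have : τ / 2 * (3 / τ) = 3 / 2 := by field_simp
    generalize slope (r τ) / r τ = q
    generalize max (x τ - a) 0 = m
    linear_combination (-4 * (x τ + τ / 2 * u τ) * u τ - 4 * (y τ + τ / 2 * v τ) * v τ) * this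
  have hc : ContinuousOn
      (fun t => t ^ 2 * P t + 2 * ((x t + t / 2 * u t) ^ 2 + (y t + t / 2 * v t) ^ 2))
      (Ici 0) := by
    have := h.continuousOn_x
    have := h.continuousOn_y
    have := h.continuousOn_u
    have := h.continuousOn_v
    have := h.continuousOn_P
    fun_prop
  have key := apply_le_of_deriv_nonpos hc hd (fun τ hτ => ?_) le_rfl ht
  · refine key.trans_eq ?_
    simp only [h.x_zero, h.y_zero]
    ring
  · have h1 : slope (r τ) / r τ * r τ ^ 2 = r τ * slope (r τ) := by
      rcases (h.r_nonneg τ).eq_or_lt with h0 | h0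
      · simp [← h0]
      · field_simp
    have h2 := profile_le_mul_slope (h.r_nonneg τ)
    have h3 := mul_le_mul_of_nonneg_left (half_sq_le_max_mul ha (x τ)) hε.le
    have h4 := h.P_eq τ
    rw [h1]
    exact mul_nonpos_of_nonneg_of_nonpos (by positivity) (by linarith)

/-- The weight $t^3$ is the integrating factor of the friction, and the central part of the force
drops out of the torque. -/
theorem deriv_moment (h : PlanarMotion ε a x y u v r P) {t : ℝ} (ht : 0 < t) :
    HasDerivAt (fun t => t ^ 3 * (x t * v t - y t * u t))
      (ε * (t ^ 3 * y t * max (x t - a) 0)) t := by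
  have h1 := (hasDerivAt_pow 3 t).mul (((h.deriv_x t ht).mul (h.deriv_v t ht)).sub
    ((h.deriv_y t ht).mul (h.deriv_u t ht)))
  refine h1.congr_deriv ?_
  simp only [Pi.sub_apply, Pi.mul_apply]
  field_simp
  norm_num
  ring

theorem continuousOn_moment (h : PlanarMotion ε a x y u v r P) :
    ContinuousOn (fun t => t ^ 3 * (x t * v t - y t * u t)) (Ici 0) := by
  have := h.continuousOn_x
  have := h.continuousOn_y
  have := h.continuousOn_u
  have := h.continuousOn_v
  fun_prop

theorem continuousOn_torque (h : PlanarMotion ε a x y u v r P) :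
    ContinuousOn (fun t => t ^ 3 * y t * max (x t - a) 0) (Ici 0) := by
  have := h.continuousOn_x
  have := h.continuousOn_y
  fun_prop

theorem moment_eq (h : PlanarMotion ε a x y u v r P) {t : ℝ} (ht : 0 ≤ t) :
    t ^ 3 * (x t * v t - y t * u t) = ε * ∫ s in (0 : ℝ)..t, s ^ 3 * y s * max (x s - a) 0 := by
  have h1 := intervalIntegral.integral_eq_sub_of_hasDerivAt_of_le ht
    (h.continuousOn_moment.mono Icc_subset_Ici_self) (fun τ hτ => h.deriv_moment hτ.1)
    ((continuousOn_const.mul h.continuousOn_torque).mono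
      (by rw [uIcc_of_le ht]; exact Icc_subset_Ici_self)).intervalIntegrable
  rw [intervalIntegral.integral_const_mul] at h1
  rw [h1]
  ring

/-- Outside the disc of radius $a$ the potential is at least $F(a)$, which the Lyapunov bound
forbids at late times. -/
theorem r_le_of_sq_lt (h : PlanarMotion ε a x y u v r P) (ha : 0 < a) (hε : 0 < ε) {t : ℝ}
    (ht : 0 ≤ t) (hat : 10 * a ^ 2 < t ^ 2 * profile a) : r t ≤ a := by
  by_contra! hr
  have h1 := h.lyapunov_le ha hε ht
  have h2 := (profile_monotone hr.le).trans (h.profile_le_P hε t)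
  have h3 := mul_le_mul_of_nonneg_left h2 (sq_nonneg t)
  nlinarith [sq_nonneg (x t + t / 2 * u t), sq_nonneg (y t + t / 2 * v t)]

end PlanarMotion

namespace PlanarMotion

variable {ε a : ℝ} {x y u v r P : ℝ → ℝ}

/-! ### The lower bound on the potential along a motion with angular momentum -/

theorem exists_sq_mul_profile_gt (ha : 0 < a) :
    ∃ τ, 0 < τ ∧ 10 * a ^ 2 < τ ^ 2 * profile a := by
  have hp := profile_pos ha
  have h0 : 0 < 10 * a ^ 2 / profile a := by positivity
  refine ⟨1 + 10 * a ^ 2 / profile a, by positivity, ?_⟩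
  rw [← div_lt_iff₀ hp]
  nlinarith

theorem bddAbove_far (h : PlanarMotion ε a x y u v r P) (ha : 0 < a) (hε : 0 < ε) {τ : ℝ}
    (hτ : 0 < τ) (hτa : 10 * a ^ 2 < τ ^ 2 * profile a) :
    τ ∈ upperBounds {t : ℝ | 0 ≤ t ∧ a < r t} := by
  rintro t ⟨ht, hr⟩
  by_contra! hlt
  have h1 := mul_le_mul_of_nonneg_right (pow_le_pow_left₀ hτ.le hlt.le 2) (profile_pos ha).le
  exact (h.r_le_of_sq_lt ha hε ht (hτa.trans_le h1)).not_gt hr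

theorem zero_mem_far (h : PlanarMotion ε a x y u v r P) (ha : 0 < a) :
    (0 : ℝ) ∈ {t : ℝ | 0 ≤ t ∧ a < r t} :=
  ⟨le_rfl, lt_of_pow_lt_pow_left₀ 2 (h.r_nonneg 0) (by rw [h.r_zero_sq]; nlinarith)⟩

theorem radialTime_le (h : PlanarMotion ε a x y u v r P) (ha : 0 < a) (hε : 0 < ε) {τ : ℝ}
    (hτ : 0 < τ) (hτa : 10 * a ^ 2 < τ ^ 2 * profile a) :
    sSup {t : ℝ | 0 ≤ t ∧ a < r t} ≤ τ :=
  csSup_le ⟨0, h.zero_mem_far ha⟩ (h.bddAbove_far ha hε hτ hτa)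

/-- After the last time with $r>a$ one has $x\le r\le a$, so the torque vanishes and $t^3L$ is
conserved. -/
theorem moment_eq_of_radialTime_le (h : PlanarMotion ε a x y u v r P) (ha : 0 < a)
    (hε : 0 < ε) {t : ℝ} (ht : sSup {t : ℝ | 0 ≤ t ∧ a < r t} ≤ t) :
    t ^ 3 * (x t * v t - y t * u t) =
      ε * ∫ s in (0 : ℝ)..sSup {t : ℝ | 0 ≤ t ∧ a < r t}, s ^ 3 * y s * max (x s - a) 0 := by
  obtain ⟨τ, hτ, hτa⟩ := exists_sq_mul_profile_gt ha
  have hbdd : BddAbove {t : ℝ | 0 ≤ t ∧ a < r t} := ⟨τ, h.bddAbove_far ha hε hτ hτa⟩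
  set T := sSup {t : ℝ | 0 ≤ t ∧ a < r t}
  have hT : 0 ≤ T := le_csSup hbdd (h.zero_mem_far ha)
  have hint : ∀ b c, 0 ≤ b → 0 ≤ c → IntervalIntegrable
      (fun s => s ^ 3 * y s * max (x s - a) 0) volume b c := fun b c hb hc =>
    (h.continuousOn_torque.mono fun s hs => (le_min hb hc).trans hs.1).intervalIntegrable
  rw [h.moment_eq (hT.trans ht),
    ← intervalIntegral.integral_add_adjacent_intervals (hint 0 T le_rfl hT)
      (hint T t hT (hT.trans ht))]
  have h0 : ∫ s in T..t, s ^ 3 * y s * max (x s - a) 0 = 0 := by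
    refine intervalIntegral.integral_zero_ae (Eventually.of_forall fun s hs => ?_)
    rw [uIoc_of_le ht] at hs
    have hr : r s ≤ a := by
      by_contra! hr
      exact (le_csSup hbdd ⟨hT.trans hs.1.le, hr⟩).not_gt hs.1
    rw [max_eq_right (by linarith [le_abs_self (x s), h.abs_x_le s]), mul_zero]
  rw [h0, add_zero]

/-- By the parallelogram law $\|\tfrac t2\dot X\|^2\le 2\|X+\tfrac t2\dot X\|^2+2\|X\|^2\le 12a^2$;
the resulting $48$ is rounded up to $7^2$. -/
theorem sq_mul_speed_le (h : PlanarMotion ε a x y u v r P) (ha : 0 < a) (hε : 0 < ε) {t : ℝ}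
    (ht : 0 ≤ t) (hr : r t ≤ a) : t ^ 2 * (u t ^ 2 + v t ^ 2) ≤ 49 * a ^ 2 := by
  have h1 := h.lyapunov_le ha hε ht
  have h2 : 0 ≤ t ^ 2 * P t := mul_nonneg (sq_nonneg t) (h.P_nonneg hε t)
  have h3 : x t ^ 2 + y t ^ 2 ≤ a ^ 2 := by
    rw [← h.r_sq]
    exact pow_le_pow_left₀ (h.r_nonneg t) hr 2
  nlinarith [sq_nonneg (2 * x t + t / 2 * u t), sq_nonneg (2 * y t + t / 2 * v t)]

theorem moment_sq_le (h : PlanarMotion ε a x y u v r P) (t : ℝ) :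
    (x t * v t - y t * u t) ^ 2 ≤ r t ^ 2 * (u t ^ 2 + v t ^ 2) := by
  rw [h.r_sq]
  nlinarith [sq_nonneg (x t * u t + y t * v t)]

theorem inv_log_le_slope {s t : ℝ} (ht : 1 < t) (h0 : (t ^ 4)⁻¹ ≤ s)
    (h1 : s ≤ Real.exp (-2)) : (4 * Real.log t)⁻¹ ≤ slope s := by
  have ht0 : 0 < (t ^ 4)⁻¹ := by positivity
  have hs := ht0.trans_le h0
  rw [slope_of_mem hs.le h1]
  have h2 := Real.log_le_log hs h1
  have h3 := Real.log_le_log ht0 h0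
  rw [Real.log_exp] at h2
  rw [Real.log_inv, Real.log_pow] at h3
  push_cast at h3
  exact inv_anti₀ (by linarith) (by linarith)

theorem potential_bounds (h : PlanarMotion ε a x y u v r P) (ha : 0 < a) (hε : 0 < ε)
    (hκ : 0 < ε * ∫ s in (0 : ℝ)..sSup {t : ℝ | 0 ≤ t ∧ a < r t},
      s ^ 3 * y s * max (x s - a) 0) :
    ∃ c₀ C₀ T₀ : ℝ, 0 < c₀ ∧ 0 < C₀ ∧ 1 < T₀ ∧ ∀ t : ℝ, T₀ ≤ t →
      c₀ / (t ^ 2 * Real.log t) ≤ P t ∧ P t ≤ C₀ / t ^ 2 := by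
  obtain ⟨τ, hτ, hτa⟩ := exists_sq_mul_profile_gt ha
  have hTle := h.radialTime_le ha hε hτ hτa
  have hmom := fun t ht => h.moment_eq_of_radialTime_le ha hε (t := t) ht
  generalize ε * ∫ s in (0 : ℝ)..sSup {t : ℝ | 0 ≤ t ∧ a < r t},
      s ^ 3 * y s * max (x s - a) 0 = κ at hκ hmom
  have hb : 0 < κ / (14 * a) := by positivity
  set b := κ / (14 * a) with hb_def
  -- Summands of $T_0$: $2$ gives $t>1$, $\tau$ puts the motion in the disc, $b^{-1}$ gives
  -- $b/t^2\ge t^{-4}$, and $be^2$ gives $b/t^2\le e^{-2}$, where the logarithmic formula for the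
  -- slope is valid.
  refine ⟨b / 4, 10 * a ^ 2, 2 + τ + b⁻¹ + b * Real.exp 2, by positivity, by positivity, ?_,
    fun t ht => ?_⟩
  · have : 0 < b⁻¹ + b * Real.exp 2 := by positivity
    linarith
  have hbi : 0 < b⁻¹ := by positivity
  have hbe : 0 < b * Real.exp 2 := by positivity
  have ht1 : 1 < t := by linarith
  have ht0 : 0 < t := by linarith
  have hr : r t ≤ a := h.r_le_of_sq_lt ha hε ht0.le (hτa.trans_le
    (mul_le_mul_of_nonneg_right (pow_le_pow_left₀ hτ.le (by linarith) 2) (profile_pos ha).le))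
  constructor
  · have h1 : κ ≤ 7 * a * t ^ 2 * r t := by
      refine le_of_sq_le_sq ?_ (mul_nonneg (by positivity) (h.r_nonneg t))
      rw [← hmom t (hTle.trans (by linarith))]
      calc (t ^ 3 * (x t * v t - y t * u t)) ^ 2
          = t ^ 6 * (x t * v t - y t * u t) ^ 2 := by ring
        _ ≤ t ^ 6 * (r t ^ 2 * (u t ^ 2 + v t ^ 2)) :=
            mul_le_mul_of_nonneg_left (h.moment_sq_le t) (by positivity)
        _ = t ^ 4 * r t ^ 2 * (t ^ 2 * (u t ^ 2 + v t ^ 2)) := by ring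
        _ ≤ t ^ 4 * r t ^ 2 * (49 * a ^ 2) :=
            mul_le_mul_of_nonneg_left (h.sq_mul_speed_le ha hε ht0.le hr) (by positivity)
        _ = (7 * a * t ^ 2 * r t) ^ 2 := by ring
    have h2 : b / t ^ 2 ≤ r t / 2 := by
      rw [hb_def, div_div, div_le_iff₀ (by positivity)]
      linarith
    have h3 : (4 * Real.log t)⁻¹ ≤ slope (b / t ^ 2) := by
      refine inv_log_le_slope ht1 ?_ ?_
      · have h4 : 1 ≤ b * t ^ 2 := by
          have : b⁻¹ ≤ t ^ 2 := by nlinarith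
          rwa [inv_le_iff_one_le_mul₀' hb] at this
        rw [inv_le_iff_one_le_mul₀ (by positivity)]
        have : b / t ^ 2 * t ^ 4 = b * t ^ 2 := by field_simp
        linarith
      · rw [Real.exp_neg, div_le_iff₀ (by positivity), ← div_eq_inv_mul,
          le_div_iff₀ (Real.exp_pos 2)]
        nlinarith
    have hlog := Real.log_pos ht1
    calc b / 4 / (t ^ 2 * Real.log t) = b / t ^ 2 * (4 * Real.log t)⁻¹ := by field_simp
      _ ≤ b / t ^ 2 * slope (b / t ^ 2) := mul_le_mul_of_nonneg_left h3 (by positivity)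
      _ ≤ r t / 2 * slope (r t / 2) :=
          mul_le_mul h2 (slope_monotone h2) (slope_nonneg _)
            (by linarith [h.r_nonneg t])
      _ ≤ profile (r t) := half_mul_slope_le_profile (h.r_nonneg t)
      _ ≤ P t := h.profile_le_P hε t
  · rw [le_div_iff₀ (by positivity), mul_comm]
    have := h.lyapunov_le ha hε ht0.le
    nlinarith [sq_nonneg (x t + t / 2 * u t), sq_nonneg (y t + t / 2 * v t)]

/-! ### Small perturbations keep the direction of motion -/

theorem P_zero_le (h : PlanarMotion ε a x y u v r P) (ha : 0 < a) (hε1 : ε ≤ 1) :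
    P 0 ≤ 2 * a + a ^ 2 := by
  have h1 := h.P_eq 0
  have h2 := profile_le_half (h.r_nonneg 0)
  have h3 : r 0 ≤ 3 * a := abs_le_of_sq_le_sq' (by rw [h.r_zero_sq]; nlinarith) (by positivity) |>.2
  rw [h.x_zero, max_eq_left (by linarith)] at h1
  nlinarith

/-- Uniform bounds on positions and velocities. -/
theorem abs_le (h : PlanarMotion ε a x y u v r P) (ha : 0 < a) (hε : 0 < ε) (hε1 : ε ≤ 1) {t : ℝ}
    (ht : 0 ≤ t) : r t ≤ 2 * (2 * a + a ^ 2) + 1 ∧ |u t| ≤ 2 * (2 * a + a ^ 2) + 1 ∧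
      |v t| ≤ 2 * (2 * a + a ^ 2) + 1 := by
  have h0 := h.P_zero_le ha hε1
  have h1 := h.r_le hε ht
  have h2 := h.speed_sq_le hε ht
  have hp : 0 < 2 * a + a ^ 2 := by positivity
  refine ⟨by linarith, ?_, ?_⟩
  · exact abs_le_of_sq_le_sq (by nlinarith [sq_nonneg (v t)]) (by positivity)
  · exact abs_le_of_sq_le_sq (by nlinarith [sq_nonneg (u t)]) (by positivity)

/-- With speed at most $R$, the first coordinate drops from $2a$ no lower than $a$ up to time $a/R$,
so the energy is at least $F(a)$ until then. Afterwards `energy_growth` limits its decay. -/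
theorem energy_lower (h : PlanarMotion ε a x y u v r P) (ha : 0 < a) (hε : 0 < ε) {R T t : ℝ}
    (hR : 0 < R) (hu : ∀ t, 0 ≤ t → |u t| ≤ R) (ht : 0 ≤ t) (htT : t ≤ T) (haT : a / R ≤ T) :
    profile a * (a / R / T) ^ 6 ≤ (u t ^ 2 + v t ^ 2) / 2 + P t := by
  have haR : 0 < a / R := by positivity
  have hT : 0 < T := haR.trans_le haT
  have hearly : ∀ s, 0 ≤ s → s ≤ a / R → profile a ≤ (u s ^ 2 + v s ^ 2) / 2 + P s := by
    intro s hs hsR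
    have h1 := apply_le_of_deriv_nonneg (h := fun t => x t + R * t) (h' := fun t => u t + R * 1)
      (h.continuousOn_x.add (continuousOn_const.mul continuousOn_id))
      (fun τ hτ => (h.deriv_x τ hτ).add ((hasDerivAt_id τ).const_mul R))
      (fun τ hτ => by linarith [(_root_.abs_le.1 (hu τ hτ.le)).1]) le_rfl hs
    simp only [h.x_zero, mul_zero, add_zero] at h1
    have h2 : R * s ≤ a := by rwa [le_div_iff₀ hR, mul_comm] at hsR
    have h3 : a ≤ r s := by linarith [le_abs_self (x s), h.abs_x_le s]
    have h4 := profile_monotone h3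
    nlinarith [h.profile_le_P hε s, sq_nonneg (u s), sq_nonneg (v s)]
  rcases le_total t (a / R) with hle | hle
  · refine le_trans ?_ (hearly t ht hle)
    refine mul_le_of_le_one_right (profile_pos ha).le (pow_le_one₀ (by positivity) ?_)
    rwa [div_le_one hT]
  · have h1 := h.energy_growth hε haR.le hle
    have h2 := mul_le_mul_of_nonneg_left (hearly _ haR.le le_rfl) (pow_nonneg haR.le 6)
    have hE : 0 ≤ (u t ^ 2 + v t ^ 2) / 2 + P t := by
      have := h.P_nonneg hε t
      positivity
    have h3 := mul_le_mul_of_nonneg_right (pow_le_pow_left₀ ht htT 6) hE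
    rw [div_pow, ← mul_div_assoc, div_le_iff₀ (by positivity)]
    linarith

/-- The phase-space norm is bounded below. -/
theorem phase_lower (h : PlanarMotion ε a x y u v r P) (ha : 0 < a) (hε1 : ε ≤ 1)
    {e k t : ℝ} (hk : 0 < k) (hk1 : k ≤ 1) (hke : 2 * k ≤ e)
    (he : e ≤ (u t ^ 2 + v t ^ 2) / 2 + P t) :
    k ^ 2 ≤ x t ^ 2 + y t ^ 2 + (u t ^ 2 + v t ^ 2) := by
  by_contra! hlt
  have h1 := h.r_sq t
  have h2 : r t < k := lt_of_pow_lt_pow_left₀ 2 hk.le (by nlinarith [sq_nonneg (u t), sq_nonneg (v t)])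
  have h3 := profile_le_half (h.r_nonneg t)
  have h4 := h.P_eq t
  have h5 : max (x t - a) 0 ^ 2 ≤ r t ^ 2 := by
    refine pow_le_pow_left₀ (le_max_right _ _) (max_le ?_ (h.r_nonneg t)) 2
    linarith [le_abs_self (x t), h.abs_x_le t]
  have h6 : ε * (1 / 2 * max (x t - a) 0 ^ 2) ≤ 1 * (1 / 2 * r t ^ 2) :=
    mul_le_mul hε1 (by linarith) (by positivity) zero_le_one
  nlinarith

end PlanarMotion

theorem abs_lin_comb_le {p q α β R S : ℝ} (hp : |p| ≤ R) (hq : |q| ≤ R) (hα : |α| ≤ S)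
    (hβ : |β| ≤ S) : |α * p + β * q| ≤ 2 * (S * R) := by
  have hS : 0 ≤ S := (abs_nonneg α).trans hα
  calc |α * p + β * q| ≤ |α * p| + |β * q| := abs_add_le _ _
    _ = |α| * |p| + |β| * |q| := by rw [abs_mul, abs_mul]
    _ ≤ S * R + S * R := by gcongr
    _ = 2 * (S * R) := by ring

/-- The derivative of the squared deviation from the line `x = 2 y`, normalised by the
phase-space norm, is controlled by the angular momentum and the size of the perturbation. -/
theorem deviation_deriv_bound {x y u v q m ε t R T K : ℝ} (hR : 0 < R) (hx : |x| ≤ R)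
    (hy : |y| ≤ R) (hu : |u| ≤ R) (hv : |v| ≤ R) (hq : 0 ≤ q) (hm : 0 ≤ m) (hmR : m ≤ R)
    (hε : 0 < ε) (ht : 0 < t) (htT : t ≤ T) (hL : |x * v - y * u| ≤ ε * R ^ 2 * t)
    (hK : |x * v - y * u| * q ≤ K) :
    (2 * (2 * y - x) * (2 * v - u) + 2 * (2 * v - u) *
        (2 * (-(3 / t * v) - q * y) - (-(3 / t * u) - (q * x + ε * m)))) *
        (x ^ 2 + y ^ 2 + (u ^ 2 + v ^ 2)) -
      ((2 * y - x) ^ 2 + (2 * v - u) ^ 2) *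
        (2 * x * u + 2 * y * v + (2 * u * (-(3 / t * u) - (q * x + ε * m)) +
          2 * v * (-(3 / t * v) - q * y))) ≤
      36 * R ^ 2 * (ε * R ^ 2 * T + K) + 168 * R ^ 4 * ε := by
  have hY : |2 * y - x| ≤ 3 * R := by
    rw [abs_le] at *; constructor <;> linarith
  have hZ : |2 * v - u| ≤ 3 * R := by
    rw [abs_le] at *; constructor <;> linarith
  have hS1 : |2 * x + y| ≤ 3 * R := by
    rw [abs_le] at *; constructor <;> linarith
  have hS2 : |-(2 * u + v)| ≤ 3 * R := by
    rw [abs_neg]; rw [abs_le] at *; constructor <;> linarith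
  have hA : |(2 * y - x) * (2 * x + y) + (2 * v - u) * -(2 * u + v)| ≤ 18 * R ^ 2 :=
    (abs_lin_comb_le hS1 hS2 hY hZ).trans_eq (by ring)
  have hB : |(2 * v - u) * (2 * x + y) + (2 * y - x) * -(-(2 * u + v))| ≤ 18 * R ^ 2 :=
    (abs_lin_comb_le hS1 (by rwa [abs_neg]) hZ hY).trans_eq (by ring)
  have hx2 : x ^ 2 ≤ R ^ 2 := sq_le_sq' (abs_le.1 hx).1 (abs_le.1 hx).2
  have hy2 : y ^ 2 ≤ R ^ 2 := sq_le_sq' (abs_le.1 hy).1 (abs_le.1 hy).2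
  have hu2 : u ^ 2 ≤ R ^ 2 := sq_le_sq' (abs_le.1 hu).1 (abs_le.1 hu).2
  have hv2 : v ^ 2 ≤ R ^ 2 := sq_le_sq' (abs_le.1 hv).1 (abs_le.1 hv).2
  have hY2 : (2 * y - x) ^ 2 ≤ (3 * R) ^ 2 := sq_le_sq' (abs_le.1 hY).1 (abs_le.1 hY).2
  have hZ2 : (2 * v - u) ^ 2 ≤ (3 * R) ^ 2 := sq_le_sq' (abs_le.1 hZ).1 (abs_le.1 hZ).2
  have hC : |(2 * v - u) * (x ^ 2 + y ^ 2 + (u ^ 2 + v ^ 2)) +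
      u * ((2 * y - x) ^ 2 + (2 * v - u) ^ 2)| ≤ 30 * R ^ 3 := by
    calc _ ≤ |(2 * v - u) * (x ^ 2 + y ^ 2 + (u ^ 2 + v ^ 2))| +
          |u * ((2 * y - x) ^ 2 + (2 * v - u) ^ 2)| := abs_add_le _ _
      _ = |2 * v - u| * (x ^ 2 + y ^ 2 + (u ^ 2 + v ^ 2)) +
          |u| * ((2 * y - x) ^ 2 + (2 * v - u) ^ 2) := by
          rw [abs_mul, abs_mul, abs_of_nonneg (a := x ^ 2 + y ^ 2 + (u ^ 2 + v ^ 2))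
            (by positivity), abs_of_nonneg (a := (2 * y - x) ^ 2 + (2 * v - u) ^ 2)
            (by positivity)]
      _ ≤ 3 * R * (R ^ 2 + R ^ 2 + (R ^ 2 + R ^ 2)) + R * ((3 * R) ^ 2 + (3 * R) ^ 2) := by
          gcongr
      _ = 30 * R ^ 3 := by ring
  set L := x * v - y * u with hLdef
  set A := (2 * y - x) * (2 * x + y) + (2 * v - u) * -(2 * u + v) with hAdef
  set B := (2 * v - u) * (2 * x + y) + (2 * y - x) * -(-(2 * u + v)) with hBdef
  set C := (2 * v - u) * (x ^ 2 + y ^ 2 + (u ^ 2 + v ^ 2)) +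
      u * ((2 * y - x) ^ 2 + (2 * v - u) ^ 2) with hCdef
  -- With $w$ the squared deviation and $N$ the squared phase-space norm, this is $w'N-wN'$. All
  -- terms without a factor $L$ or $\varepsilon$ cancel, since $(2v-u)(2x+y)-(2y-x)(2u+v)=5L$.
  have hid : (2 * (2 * y - x) * (2 * v - u) + 2 * (2 * v - u) *
        (2 * (-(3 / t * v) - q * y) - (-(3 / t * u) - (q * x + ε * m)))) *
        (x ^ 2 + y ^ 2 + (u ^ 2 + v ^ 2)) -
      ((2 * y - x) ^ 2 + (2 * v - u) ^ 2) *
        (2 * x * u + 2 * y * v + (2 * u * (-(3 / t * u) - (q * x + ε * m)) +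
          2 * v * (-(3 / t * v) - q * y))) =
      2 * (L * A) + 2 * -(L * q * A) + 6 * -(L / t * B) + 2 * ε * (m * C) := by
    rw [hLdef, hAdef, hBdef, hCdef, div_eq_mul_inv 3 t, div_eq_mul_inv _ t]
    ring
  rw [hid]
  have h1 : L * A ≤ ε * R ^ 2 * T * (18 * R ^ 2) := by
    refine (le_abs_self _).trans ?_
    rw [abs_mul]
    have : ε * R ^ 2 * t ≤ ε * R ^ 2 * T := by gcongr
    have hT : 0 ≤ T := ht.le.trans htT
    exact mul_le_mul (hL.trans this) hA (abs_nonneg _) (by positivity)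
  have h2 : -(L * q * A) ≤ K * (18 * R ^ 2) := by
    refine (neg_le_abs _).trans ?_
    rw [abs_mul, abs_mul, abs_of_nonneg hq]
    have : 0 ≤ K := le_trans (by positivity) hK
    gcongr
  have h3 : -(L / t * B) ≤ ε * R ^ 2 * (18 * R ^ 2) := by
    refine (neg_le_abs _).trans ?_
    rw [abs_mul, abs_div, abs_of_pos ht]
    gcongr
    rwa [div_le_iff₀ ht]
  have h4 : m * C ≤ R * (30 * R ^ 3) := by
    refine (le_abs_self _).trans ?_
    rw [abs_mul, abs_of_nonneg hm]
    gcongr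
  have h5 := mul_le_mul_of_nonneg_left h4 hε.le
  linarith

namespace PlanarMotion

variable {ε a : ℝ} {x y u v r P : ℝ → ℝ}

/-- The torque is at most $\varepsilon t^3R^2$ in size. The spare factor $t$ later absorbs the
singular friction coefficient $3/t$. -/
theorem abs_moment_le (h : PlanarMotion ε a x y u v r P) (ha : 0 < a) (hε : 0 < ε) {R t : ℝ}
    (hr : ∀ t, 0 ≤ t → r t ≤ R) (ht : 0 < t) : |x t * v t - y t * u t| ≤ ε * R ^ 2 * t := by
  have hR : 0 ≤ R := (h.r_nonneg 0).trans (hr 0 le_rfl)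
  have h1 : ‖∫ s in (0 : ℝ)..t, s ^ 3 * y s * max (x s - a) 0‖ ≤ t ^ 3 * R ^ 2 * |t - 0| := by
    refine intervalIntegral.norm_integral_le_of_norm_le_const fun s hs => ?_
    rw [uIoc_of_le ht.le] at hs
    have h2 : max (x s - a) 0 ≤ R :=
      max_le (by linarith [le_abs_self (x s), h.abs_x_le s, hr s hs.1.le]) hR
    have h3 : |y s| ≤ R := (h.abs_y_le s).trans (hr s hs.1.le)
    rw [norm_mul, norm_mul, Real.norm_of_nonneg (le_max_right _ _), Real.norm_eq_abs,
      Real.norm_eq_abs, abs_of_nonneg (pow_nonneg hs.1.le 3), mul_assoc, pow_two]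
    have := hs.1.le
    have := hs.2
    gcongr
  have h2 := congrArg (fun z => |z|) (h.moment_eq ht.le)
  simp only [abs_mul, abs_of_pos hε, abs_of_pos (pow_pos ht 3)] at h2
  rw [sub_zero, abs_of_pos ht, Real.norm_eq_abs] at h1
  have h3 := mul_le_mul_of_nonneg_left h1 hε.le
  rw [← h2] at h3
  have h4 : 0 < t ^ 3 := pow_pos ht 3
  refine le_of_mul_le_mul_left (h3.trans_eq ?_) h4
  ring

/-- The factor $F'(r)/r$ is singular at the origin. For $r\ge\eta$ it is at most $1/(2\eta)$ and the
smallness of $L$ suffices; for $r<\eta$ the bound $|L|\le 2Rr$ cancels the $1/r$ and leaves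
$2RF'(\eta)$. -/
theorem abs_moment_mul_le (h : PlanarMotion ε a x y u v r P) {R T η t : ℝ}
    (hη : 0 < η) (hu : |u t| ≤ R) (hv : |v t| ≤ R) (ht : 0 < t) (htT : t ≤ T) (hε : 0 < ε)
    (hL : |x t * v t - y t * u t| ≤ ε * R ^ 2 * t) :
    |x t * v t - y t * u t| * (slope (r t) / r t) ≤
      2 * R * slope η + ε * R ^ 2 * T / (2 * η) := by
  have hR : 0 ≤ R := (abs_nonneg _).trans hu
  have hT : 0 < T := ht.trans_le htT
  rcases le_or_gt η (r t) with hr | hr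
  · have h1 : slope (r t) / r t ≤ 1 / 2 / η :=
      div_le_div₀ (by norm_num) (slope_le_half _) hη hr
    have h2 : |x t * v t - y t * u t| * (slope (r t) / r t) ≤ ε * R ^ 2 * T * (1 / 2 / η) := by
      refine mul_le_mul (hL.trans (by gcongr)) h1 ?_ (by positivity)
      exact div_nonneg (slope_nonneg _) (h.r_nonneg t)
    have h3 : ε * R ^ 2 * T * (1 / 2 / η) = ε * R ^ 2 * T / (2 * η) := by field_simp
    have h4 : 0 ≤ 2 * R * slope η := mul_nonneg (by positivity) (slope_nonneg _)
    linarith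
  · have h1 : |x t * v t - y t * u t| ≤ 2 * R * r t := by
      have := abs_lin_comb_le (p := x t) (q := y t) (α := v t) (β := -u t) (R := r t) (S := R)
        (h.abs_x_le t) (h.abs_y_le t) hv (by rwa [abs_neg])
      calc |x t * v t - y t * u t| = |v t * x t + -u t * y t| := by ring_nf
        _ ≤ 2 * (R * r t) := this
        _ = 2 * R * r t := by ring
    have h2 : |x t * v t - y t * u t| * (slope (r t) / r t) ≤ 2 * R * slope η := by
      calc _ ≤ 2 * R * r t * (slope (r t) / r t) :=
            mul_le_mul_of_nonneg_right h1 (div_nonneg (slope_nonneg _) (h.r_nonneg t))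
        _ = 2 * R * (r t * (slope (r t) / r t)) := by ring
        _ ≤ 2 * R * slope η := by
            refine mul_le_mul_of_nonneg_left ?_ (by positivity)
            rcases (h.r_nonneg t).eq_or_lt with h0 | h0
            · rw [← h0, zero_mul]; exact slope_nonneg _
            · rw [mul_div_cancel₀ _ h0.ne']
              exact slope_monotone hr.le
    have h4 : 0 ≤ ε * R ^ 2 * T / (2 * η) := by positivity
    linarith

/-- The squared deviation from the line through the origin and the starting point, in terms of
the size of the perturbation. -/
theorem deviation_le (h : PlanarMotion ε a x y u v r P) (ha : 0 < a) (hε : 0 < ε) {R T k η : ℝ}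
    (hr : ∀ t, 0 ≤ t → r t ≤ R) (hu : ∀ t, 0 ≤ t → |u t| ≤ R) (hv : ∀ t, 0 ≤ t → |v t| ≤ R)
    (hk : 0 < k) (hη : 0 < η)
    (hN : ∀ t, 0 ≤ t → t ≤ T → k ≤ x t ^ 2 + y t ^ 2 + (u t ^ 2 + v t ^ 2))
    {t : ℝ} (ht : 0 ≤ t) (htT : t ≤ T) :
    (2 * y t - x t) ^ 2 ≤ 4 * R ^ 2 * T / k ^ 2 *
      (36 * R ^ 2 * (ε * R ^ 2 * T + (2 * R * slope η + ε * R ^ 2 * T / (2 * η))) +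
        168 * R ^ 4 * ε) := by
  have hR : 0 < R := lt_of_lt_of_le
    (lt_of_pow_lt_pow_left₀ 2 (h.r_nonneg 0) (by rw [h.r_zero_sq]; nlinarith)) (hr 0 le_rfl)
  set σ := 36 * R ^ 2 * (ε * R ^ 2 * T + (2 * R * slope η + ε * R ^ 2 * T / (2 * η))) +
        168 * R ^ 4 * ε with hσ
  set w : ℝ → ℝ := fun s => (2 * y s - x s) ^ 2 + (2 * v s - u s) ^ 2 with hw
  set N : ℝ → ℝ := fun s => x s ^ 2 + y s ^ 2 + (u s ^ 2 + v s ^ 2) with hNdef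
  have hNpos : ∀ s, 0 ≤ s → s ≤ T → 0 < N s := fun s h0 h1 => hk.trans_le (hN s h0 h1)
  have hT : 0 ≤ T := ht.trans htT
  have hσ0 : 0 ≤ σ := by
    have := slope_nonneg η
    rw [hσ]; positivity
  have hwc : ContinuousOn w (Ici 0) := by
    have := h.continuousOn_x
    have := h.continuousOn_y
    have := h.continuousOn_u
    have := h.continuousOn_v
    rw [hw]; fun_prop
  have hNc : ContinuousOn N (Ici 0) := by
    have := h.continuousOn_x
    have := h.continuousOn_y
    have := h.continuousOn_u
    have := h.continuousOn_v
    rw [hNdef]; fun_prop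
  -- The quotient $w/N$ has derivative at most $\sigma/N^2\le\sigma/k^2$. It starts at $0$: the
  -- initial point lies on the line and is at rest.
  have hanti : AntitoneOn (fun s => w s / N s - σ / k ^ 2 * s) (Icc 0 T) := by
    have hder : ∀ s ∈ Ioo 0 T, ∃ d, HasDerivAt (fun s => w s / N s - σ / k ^ 2 * s) d s ∧
        d ≤ 0 := by
      intro s hs
      have hwd := (((((h.deriv_y s hs.1).const_mul 2).sub (h.deriv_x s hs.1)).pow 2).add
        ((((h.deriv_v s hs.1).const_mul 2).sub (h.deriv_u s hs.1)).pow 2))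
      have hNd := ((((h.deriv_x s hs.1).pow 2).add ((h.deriv_y s hs.1).pow 2)).add
        (((h.deriv_u s hs.1).pow 2).add ((h.deriv_v s hs.1).pow 2)))
      have hdiv := (hwd.div hNd (hNpos s hs.1.le hs.2.le).ne').sub
        ((hasDerivAt_id s).const_mul (σ / k ^ 2))
      refine ⟨_, hdiv, ?_⟩
      have hL := h.abs_moment_le ha hε hr hs.1
      have hb := deviation_deriv_bound hR ((h.abs_x_le s).trans (hr s hs.1.le))
        ((h.abs_y_le s).trans (hr s hs.1.le)) (hu s hs.1.le) (hv s hs.1.le)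
        (div_nonneg (slope_nonneg _) (h.r_nonneg s)) (le_max_right (x s - a) 0)
        (max_le (by linarith [le_abs_self (x s), h.abs_x_le s, hr s hs.1.le]) hR.le)
        hε hs.1 hs.2.le hL
        (h.abs_moment_mul_le hη (hu s hs.1.le) (hv s hs.1.le) hs.1 hs.2.le hε hL)
      rw [sub_nonpos, mul_one]
      refine div_le_div₀ hσ0 ?_ (by positivity)
        (pow_le_pow_left₀ hk.le (hN s hs.1.le hs.2.le) 2)
      refine le_trans (le_of_eq ?_) hb
      simp only [Pi.add_apply, Pi.sub_apply, Pi.pow_apply, Nat.cast_ofNat, Nat.add_one_sub_one,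
        pow_one]
    refine antitoneOn_of_deriv_nonpos (convex_Icc 0 T) ?_ ?_ ?_
    · refine ContinuousOn.sub (ContinuousOn.div (hwc.mono Icc_subset_Ici_self)
        (hNc.mono Icc_subset_Ici_self) fun s hs => (hNpos s hs.1 hs.2).ne') (by fun_prop)
    · rw [interior_Icc]
      intro s hs
      obtain ⟨d, hd, -⟩ := hder s hs
      exact hd.differentiableAt.differentiableWithinAt
    · rw [interior_Icc]
      intro s hs
      obtain ⟨d, hd, hd0⟩ := hder s hs
      exact hd.deriv.trans_le hd0
  have h1 := hanti ⟨le_rfl, hT⟩ ⟨ht, htT⟩ ht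
  have hw0 : w 0 = 0 := by
    simp [hw, h.x_zero, h.y_zero, h.u_zero, h.v_zero]
  simp only [hw0, zero_div, mul_zero, sub_zero, sub_nonpos] at h1
  rw [div_le_iff₀ (hNpos t ht htT)] at h1
  have hsq : ∀ z : ℝ, |z| ≤ R → z ^ 2 ≤ R ^ 2 := fun z hz =>
    sq_le_sq' (_root_.abs_le.1 hz).1 (_root_.abs_le.1 hz).2
  have hNle : N t ≤ 4 * R ^ 2 := by
    have h2 := hsq _ ((h.abs_x_le t).trans (hr t ht))
    have h3 := hsq _ ((h.abs_y_le t).trans (hr t ht))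
    have h4 := hsq _ (hu t ht)
    have h5 := hsq _ (hv t ht)
    simp only [hNdef]
    linarith
  calc (2 * y t - x t) ^ 2 ≤ w t := by simp only [hw]; nlinarith [sq_nonneg (2 * v t - u t)]
    _ ≤ σ / k ^ 2 * t * N t := h1
    _ ≤ σ / k ^ 2 * T * (4 * R ^ 2) := by
        have := (hNpos t ht htT).le
        gcongr
    _ = 4 * R ^ 2 * T / k ^ 2 * σ := by ring

/-- For small perturbations the trajectory stays close to the line `x = 2 y`. -/
theorem exists_deviation_lt (ha : 0 < a) (T₁ : ℝ) : ∃ ε₀ : ℝ, 0 < ε₀ ∧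
    ∀ ε : ℝ, 0 < ε → ε < ε₀ → ∀ x y u v r P : ℝ → ℝ, PlanarMotion ε a x y u v r P →
      ∀ t, 0 ≤ t → t ≤ T₁ → (2 * y t - x t) ^ 2 < a ^ 2 := by
  set R := 2 * (2 * a + a ^ 2) + 1 with hRdef
  have hR : 0 < R := by positivity
  set T := max T₁ (a / R) with hTdef
  have hT : 0 < T := lt_max_of_lt_right (by positivity)
  set e := profile a * (a / R / T) ^ 6 with hedef
  have he : 0 < e := mul_pos (profile_pos ha) (by positivity)
  set k := min 1 (e / 2) with hkdef
  have hk : 0 < k := lt_min one_pos (by positivity)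
  set M := 4 * R ^ 2 * T / (k ^ 2) ^ 2 with hM
  have hMpos : 0 < M := by positivity
  -- The radius $\eta$ is fixed before $\varepsilon$, using $F'(\eta)\to0$. What remains of the
  -- bound is linear in $\varepsilon$, with coefficient `Q`.
  obtain ⟨η, hη, hηs⟩ : ∃ η, 0 < η ∧ M * (72 * R ^ 3) * slope η < a ^ 2 / 2 := by
    have h1 : Tendsto (fun η => M * (72 * R ^ 3) * slope η) (𝓝[>] 0) (𝓝 0) := by
      have h2 : Tendsto slope (𝓝[>] 0) (𝓝 (slope 0)) :=
        (slope_continuous.tendsto 0).mono_left nhdsWithin_le_nhds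
      simpa [slope_of_nonpos] using h2.const_mul (M * (72 * R ^ 3))
    obtain ⟨η, h3, h4⟩ := ((h1.eventually (gt_mem_nhds (show (0 : ℝ) < a ^ 2 / 2 by positivity))).and
      self_mem_nhdsWithin).exists
    exact ⟨η, h4, h3⟩
  set Q := M * (36 * R ^ 2 * (R ^ 2 * T + R ^ 2 * T / (2 * η)) + 168 * R ^ 4) with hQ
  have hQpos : 0 < Q := by positivity
  refine ⟨min 1 (a ^ 2 / 2 / Q), by positivity, fun ε hε hε0 x y u v r P h t ht htT => ?_⟩
  have hε1 : ε ≤ 1 := hε0.le.trans (min_le_left _ _)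
  have hεQ : ε * Q < a ^ 2 / 2 := (lt_div_iff₀ hQpos).1 (hε0.trans_le (min_le_right _ _))
  have hb := fun s hs => h.abs_le ha hε hε1 (t := s) hs
  have h1 := h.deviation_le ha hε (R := R) (T := T) (k := k ^ 2) (η := η)
    (fun s hs => (hb s hs).1) (fun s hs => (hb s hs).2.1) (fun s hs => (hb s hs).2.2)
    (by positivity) hη
    (fun s hs hsT => h.phase_lower ha hε1 hk (min_le_left _ _)
      (by linarith [min_le_right 1 (e / 2)])
      (h.energy_lower ha hε hR (fun s hs => (hb s hs).2.1) hs hsT (le_max_right _ _)))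
    ht (htT.trans (le_max_left _ _))
  refine h1.trans_lt ?_
  have h2 : 4 * R ^ 2 * T / (k ^ 2) ^ 2 *
      (36 * R ^ 2 * (ε * R ^ 2 * T + (2 * R * slope η + ε * R ^ 2 * T / (2 * η))) +
        168 * R ^ 4 * ε) = M * (72 * R ^ 3) * slope η + ε * Q := by
    rw [hQ, hM]; ring
  rw [h2]
  linarith

/-- The constant of angular momentum is positive for small perturbations. -/
theorem exists_angularConstant_pos (ha : 0 < a) : ∃ ε₀ : ℝ, 0 < ε₀ ∧
    ∀ ε : ℝ, 0 < ε → ε < ε₀ → ∀ x y u v r P : ℝ → ℝ, PlanarMotion ε a x y u v r P →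
      0 < ε * ∫ s in (0 : ℝ)..sSup {t : ℝ | 0 ≤ t ∧ a < r t},
        s ^ 3 * y s * max (x s - a) 0 := by
  obtain ⟨τ, hτ, hτa⟩ := exists_sq_mul_profile_gt ha
  obtain ⟨ε₀, hε₀, hdev⟩ := exists_deviation_lt ha τ
  refine ⟨ε₀, hε₀, fun ε hε hεε x y u v r P h => mul_pos hε ?_⟩
  have hdev := hdev ε hε hεε x y u v r P h
  have hTle := h.radialTime_le ha hε hτ hτa
  have hbdd : BddAbove {t : ℝ | 0 ≤ t ∧ a < r t} := ⟨τ, h.bddAbove_far ha hε hτ hτa⟩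
  -- Just after time $0$ the integrand is strictly positive; at $0$ itself the factor $s^3$
  -- vanishes.
  have hev : ∀ᶠ t in 𝓝[>] (0 : ℝ), 0 < t ∧ a < r t ∧ a < x t ∧ 0 < y t := by
    have hsub : 𝓝[>] (0 : ℝ) ≤ 𝓝[≥] 0 := nhdsWithin_mono _ Ioi_subset_Ici_self
    have h1 := ((h.continuousOn_r 0 self_mem_Ici).mono_left hsub).eventually
      (lt_mem_nhds (h.zero_mem_far ha).2)
    have h2 := ((h.continuousOn_x 0 self_mem_Ici).mono_left hsub).eventually
      (lt_mem_nhds (show a < x 0 by rw [h.x_zero]; linarith))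
    have h3 := ((h.continuousOn_y 0 self_mem_Ici).mono_left hsub).eventually
      (lt_mem_nhds (show 0 < y 0 by rw [h.y_zero]; exact ha))
    filter_upwards [h1, h2, h3, self_mem_nhdsWithin] with t h1 h2 h3 h4
    exact ⟨h4, h1, h2, h3⟩
  obtain ⟨s, hs0, hsr, hsx, hsy⟩ := hev.exists
  have hsT := le_csSup hbdd ⟨hs0.le, hsr⟩
  refine intervalIntegral.integral_pos (hs0.trans_le hsT)
    (h.continuousOn_torque.mono Icc_subset_Ici_self) ?_ ⟨s, ⟨hs0.le, hsT⟩, ?_⟩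
  · intro t ht
    rcases le_or_gt (x t) a with hx | hx
    · rw [max_eq_right (by linarith), mul_zero]
    · have hd := hdev t ht.1.le (ht.2.trans hTle)
      -- From $2y-x>-a$ and $x>a$.
      have hy : 0 ≤ y t := by
        have := (abs_lt_of_sq_lt_sq' hd ha.le).1
        linarith
      have := ht.1
      positivity
  · have : 0 < max (x s - a) 0 := lt_max_of_lt_left (by linarith)
    positivity

end PlanarMotion

/-! ### Existence of solutions -/

section Existence

variable {E : Type*} [NormedAddCommGroup E] [NormedSpace ℝ E]

/-- The weighted mean `∫₀¹ τ³ G(sτ) dτ`. -/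
def cubicMean (G : ℝ → E) (s : ℝ) : E := ∫ τ in (0 : ℝ)..1, τ ^ 3 • G (s * τ)

/-- The position at time `t` of a particle released at rest from `x₀` under the friction `3/t`
and the force `-G`. -/
def response (x₀ : E) (G : ℝ → E) (t : ℝ) : E := x₀ - ∫ s in (0 : ℝ)..t, s • cubicMean G s

theorem continuous_cubicMean {G : ℝ → E} (hG : Continuous G) : Continuous (cubicMean G) := by
  refine intervalIntegral.continuous_parametric_intervalIntegral_of_continuous' ?_ 0 1
  simp only [Function.uncurry_def]
  fun_prop

theorem norm_cubicMean_le {G : ℝ → E} {s B : ℝ}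
    (hB : ∀ τ, 0 < τ → τ ≤ 1 → ‖G (s * τ)‖ ≤ B) : ‖cubicMean G s‖ ≤ B := by
  have h := intervalIntegral.norm_integral_le_of_norm_le_const (a := 0) (b := 1) (C := B)
    (f := fun τ : ℝ => τ ^ 3 • G (s * τ)) fun τ hτ => by
      rw [uIoc_of_le zero_le_one] at hτ
      rw [norm_smul, norm_pow, Real.norm_of_nonneg hτ.1.le]
      exact (mul_le_of_le_one_left (norm_nonneg _) (pow_le_one₀ hτ.1.le hτ.2)).trans
        (hB τ hτ.1 hτ.2)
  simpa [cubicMean] using h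

/-- Integrating $(t^3\dot X)'=-t^3G$ gives minus the right side as velocity; rescaling
$\sigma=t\tau$ removes the singularity at $t=0$. -/
theorem smul_cubicMean {G : ℝ → E} {t : ℝ} (ht : 0 < t) :
    t • cubicMean G t = (t ^ 3)⁻¹ • ∫ σ in (0 : ℝ)..t, σ ^ 3 • G σ := by
  have h1 := intervalIntegral.smul_integral_comp_mul_left (a := 0) (b := 1)
    (fun σ => σ ^ 3 • G σ) t
  rw [mul_zero, mul_one] at h1
  rw [← h1]
  have h2 : ∀ τ : ℝ, (t * τ) ^ 3 • G (t * τ) = t ^ 3 • (τ ^ 3 • G (t * τ)) := fun τ => by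
    rw [smul_smul, mul_pow]
  simp only [h2]
  rw [intervalIntegral.integral_smul, smul_smul, smul_smul, cubicMean]
  congr 1
  field_simp

theorem response_zero (x₀ : E) (G : ℝ → E) : response x₀ G 0 = x₀ := by
  simp [response]

theorem response_congr {x₀ : E} {G G' : ℝ → E} {t : ℝ} (ht : 0 ≤ t)
    (h : ∀ s, 0 ≤ s → s ≤ t → G s = G' s) : response x₀ G t = response x₀ G' t := by
  unfold response
  congr 1
  refine intervalIntegral.integral_congr fun s hs => ?_
  rw [uIcc_of_le ht] at hs
  have : cubicMean G s = cubicMean G' s := by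
    refine intervalIntegral.integral_congr fun τ hτ => ?_
    rw [uIcc_of_le zero_le_one] at hτ
    rw [h _ (mul_nonneg hs.1 hτ.1) ((mul_le_of_le_one_right hs.1 hτ.2).trans hs.2)]
  simp only [this]

theorem intervalIntegrable_smul_cubicMean {G : ℝ → E} (hG : Continuous G) (b c : ℝ) :
    IntervalIntegrable (fun s => s • cubicMean G s) volume b c :=
  (continuous_id.smul (continuous_cubicMean hG)).intervalIntegrable b c

theorem hasDerivAt_response [CompleteSpace E] (x₀ : E) {G : ℝ → E} (hG : Continuous G) (t : ℝ) :
    HasDerivAt (response x₀ G) (-(t • cubicMean G t)) t := by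
  have hc : Continuous fun s : ℝ => s • cubicMean G s := continuous_id.smul (continuous_cubicMean hG)
  exact (intervalIntegral.integral_hasDerivAt_right (hc.intervalIntegrable _ _)
    (hc.stronglyMeasurableAtFilter _ _) hc.continuousAt).const_sub x₀

theorem continuous_response [CompleteSpace E] (x₀ : E) {G : ℝ → E} (hG : Continuous G) :
    Continuous (response x₀ G) :=
  continuous_iff_continuousAt.2 fun t => (hasDerivAt_response x₀ hG t).continuousAt

theorem tendsto_response {x₀ : E} {G : ℕ → ℝ → E} {H : ℝ → E} {β : ℝ → ℝ}
    (hG : ∀ n, Continuous (G n)) (hβ : Continuous β) (hb : ∀ n s, ‖G n s‖ ≤ β s)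
    (hlim : ∀ s, Tendsto (fun n => G n s) atTop (𝓝 (H s))) (t : ℝ) :
    Tendsto (fun n => response x₀ (G n) t) atTop (𝓝 (response x₀ H t)) := by
  have hβ2 : Continuous fun s : ℝ => ∫ τ in (0 : ℝ)..1, |τ| ^ 3 * β (s * τ) := by
    refine intervalIntegral.continuous_parametric_intervalIntegral_of_continuous' ?_ 0 1
    simp only [Function.uncurry_def]
    fun_prop
  have hbound : ∀ n s τ, ‖τ ^ 3 • G n (s * τ)‖ ≤ |τ| ^ 3 * β (s * τ) := fun n s τ => by
    rw [norm_smul, norm_pow, Real.norm_eq_abs]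
    exact mul_le_mul_of_nonneg_left (hb n _) (by positivity)
  have hint : ∀ s : ℝ, IntervalIntegrable (fun τ => |τ| ^ 3 * β (s * τ)) volume 0 1 := fun s =>
    Continuous.intervalIntegrable (by fun_prop) _ _
  have hmean : ∀ s, Tendsto (fun n => cubicMean (G n) s) atTop (𝓝 (cubicMean H s)) := by
    intro s
    refine intervalIntegral.tendsto_integral_filter_of_dominated_convergence
      (fun τ => |τ| ^ 3 * β (s * τ)) (Eventually.of_forall fun n => ?_)
      (Eventually.of_forall fun n => Eventually.of_forall fun τ _ => hbound n s τ) (hint s)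
      (Eventually.of_forall fun τ _ => (hlim _).const_smul _)
    have := hG n
    exact Continuous.aestronglyMeasurable (by fun_prop)
  refine tendsto_const_nhds.sub ?_
  refine intervalIntegral.tendsto_integral_filter_of_dominated_convergence
    (fun s => |s| * ∫ τ in (0 : ℝ)..1, |τ| ^ 3 * β (s * τ)) (Eventually.of_forall fun n => ?_)
    (Eventually.of_forall fun n => Eventually.of_forall fun s _ => ?_)
    ((continuous_abs.mul hβ2).intervalIntegrable _ _)
    (Eventually.of_forall fun s _ => (hmean s).const_smul _)
  · exact (continuous_id.smul (continuous_cubicMean (hG n))).aestronglyMeasurable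
  · rw [norm_smul, Real.norm_eq_abs]
    refine mul_le_mul_of_nonneg_left ?_ (abs_nonneg s)
    exact intervalIntegral.norm_integral_le_of_norm_le zero_le_one
      (Eventually.of_forall fun τ _ => hbound n s τ) (hint s)

/-- A pointwise Arzelà–Ascoli theorem for curves with a common modulus of continuity. -/
theorem exists_tendsto_subseq {F : Type*} [NormedAddCommGroup F] [ProperSpace F]
    {Z : ℕ → ℝ → F} {Λ : ℝ → ℝ} {x₀ : F}
    (hΛ : Continuous Λ) (hZ : ∀ n s t, dist (Z n s) (Z n t) ≤ |Λ s - Λ t|)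
    (h0 : ∀ n, Z n 0 = x₀) :
    ∃ φ : ℕ → ℕ, StrictMono φ ∧ ∃ W : ℝ → F, ∀ t,
      Tendsto (fun n => Z (φ n) t) atTop (𝓝 (W t)) := by
  have hcont : ∀ h : ℝ → F, (∀ s t, dist (h s) (h t) ≤ |Λ s - Λ t|) → Continuous h := by
    intro h hh
    refine continuous_iff_continuousAt.2 fun s => tendsto_iff_dist_tendsto_zero.2 ?_
    refine squeeze_zero (fun _ => dist_nonneg) (fun t => hh t s) ?_
    have : Continuous fun t => |Λ t - Λ s| := by fun_prop
    simpa using this.tendsto s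
  let S : Set C(ℝ, F) := {h | h 0 = x₀ ∧ ∀ s t, dist (h s) (h t) ≤ |Λ s - Λ t|}
  -- Compactness is needed only for pointwise convergence: the conditions are closed in a product of
  -- closed balls, which is compact by Tychonoff.
  have hS1 : IsCompact (ContinuousMap.toFun '' S) := by
    have himg : ContinuousMap.toFun '' S =
        {h : ℝ → F | h 0 = x₀ ∧ ∀ s t, dist (h s) (h t) ≤ |Λ s - Λ t|} := by
      ext h
      constructor
      · rintro ⟨h, hh, rfl⟩
        exact hh
      · exact fun hh => ⟨⟨h, hcont h hh.2⟩, hh, rfl⟩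
    rw [himg]
    refine (isCompact_univ_pi fun t : ℝ =>
      isCompact_closedBall x₀ |Λ t - Λ 0|).of_isClosed_subset ?_ ?_
    · have hset : {h : ℝ → F | ∀ s t, dist (h s) (h t) ≤ |Λ s - Λ t|} =
          ⋂ s, ⋂ t, {h : ℝ → F | dist (h s) (h t) ≤ |Λ s - Λ t|} := by
        ext h; simp
      have hclosed : IsClosed {h : ℝ → F | ∀ s t, dist (h s) (h t) ≤ |Λ s - Λ t|} := by
        rw [hset]
        exact isClosed_iInter fun s => isClosed_iInter fun t =>
          isClosed_le ((continuous_apply s).dist (continuous_apply t)) continuous_const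
      exact (isClosed_eq (continuous_apply 0) continuous_const).inter hclosed
    · intro h hh t _
      have := hh.2 t 0
      rwa [hh.1] at this
  have hS2 : Equicontinuous ((↑) : S → ℝ → F) := by
    intro s
    refine Metric.equicontinuousAt_of_continuity_modulus (fun t => |Λ s - Λ t|) ?_ _
      (Eventually.of_forall fun t h => h.2.2 s t)
    have : Continuous fun t => |Λ s - Λ t| := by fun_prop
    simpa using this.tendsto s
  obtain ⟨W, -, φ, hφ, hlim⟩ := (ArzelaAscoli.isCompact_of_equicontinuous S hS1 hS2).tendsto_subseq
    (x := fun n => (⟨Z n, hcont _ (hZ n)⟩ : C(ℝ, F))) fun n => ⟨h0 n, hZ n⟩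
  exact ⟨φ, hφ, W, fun t => ((ContinuousEvalConst.continuous_eval_const t).tendsto W).comp hlim⟩

/-- Iterates of the response to the force delayed by `δ`. -/
def delayedIterate (g : E → E) (x₀ : E) (δ : ℝ) : ℕ → ℝ → E
  | 0 => fun _ => x₀
  | k + 1 => response x₀ fun s => g (delayedIterate g x₀ δ k (max (s - δ) 0))

theorem continuous_delayedIterate [CompleteSpace E] {g : E → E} (hg : Continuous g) (x₀ : E)
    (δ : ℝ) (k : ℕ) : Continuous (delayedIterate g x₀ δ k) := by
  induction k with
  | zero => exact continuous_const
  | succ k ih => exact continuous_response x₀ (by fun_prop)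

/-- With delay $\delta$, an iterate on $[0,(k+1)\delta]$ depends only on its predecessor on
$[0,k\delta]$. The iterates therefore stabilise and solve the delayed equation on growing intervals.
-/
theorem delayedIterate_succ_eq (g : E → E) (x₀ : E) {δ : ℝ} (hδ : 0 ≤ δ) (k : ℕ) :
    ∀ t, 0 ≤ t → t ≤ k * δ → delayedIterate g x₀ δ (k + 1) t = delayedIterate g x₀ δ k t := by
  induction k with
  | zero =>
    intro t h0 h1
    have : t = 0 := le_antisymm (by simpa using h1) h0
    rw [this]
    exact response_zero _ _
  | succ k ih =>
    intro t h0 h1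
    refine response_congr h0 fun s hs hst => ?_
    rw [ih _ (le_max_right _ _) (max_le ?_ (by positivity))]
    push_cast at h1
    linarith

theorem hasDerivAt_exp_sq (A c t : ℝ) :
    HasDerivAt (fun s => A * Real.exp (c * s ^ 2)) (t * (2 * c * A * Real.exp (c * t ^ 2))) t := by
  have h := (((hasDerivAt_pow 2 t).const_mul c).exp).const_mul A
  refine h.congr_deriv ?_
  simp only [Nat.cast_ofNat, Nat.add_one_sub_one, pow_one]
  ring

theorem norm_smul_cubicMean_le {G : ℝ → E} {A c : ℝ} (hA : 0 ≤ A) (hc : 0 ≤ c)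
    (hG : ∀ s, ‖G s‖ ≤ 2 * c * A * Real.exp (c * s ^ 2)) (s : ℝ) :
    ‖s • cubicMean G s‖ ≤ |s| * (2 * c * A * Real.exp (c * s ^ 2)) := by
  rw [norm_smul, Real.norm_eq_abs]
  refine mul_le_mul_of_nonneg_left (norm_cubicMean_le fun τ h0 h1 => (hG _).trans ?_) (abs_nonneg s)
  have : (s * τ) ^ 2 ≤ s ^ 2 := by
    rw [mul_pow]
    exact mul_le_of_le_one_right (sq_nonneg s) (pow_le_one₀ h0.le h1)
  gcongr

/-- The majorant reproduces itself: $\int_0^t s\cdot 2cAe^{cs^2}\,ds=A(e^{ct^2}-1)$. Hence linear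
growth of the force bounds all iterates uniformly in the delay. -/
theorem norm_response_le {x₀ : E} {G : ℝ → E} {A c : ℝ} (hA : ‖x₀‖ ≤ A) (hc : 0 ≤ c)
    (hG : ∀ s, ‖G s‖ ≤ 2 * c * A * Real.exp (c * s ^ 2)) {t : ℝ} (ht : 0 ≤ t) :
    ‖response x₀ G t‖ ≤ A * Real.exp (c * t ^ 2) := by
  have hA0 := (norm_nonneg x₀).trans hA
  have hcont : Continuous fun s => s * (2 * c * A * Real.exp (c * s ^ 2)) := by fun_prop
  have h1 : ‖∫ s in (0 : ℝ)..t, s • cubicMean G s‖ ≤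
      ∫ s in (0 : ℝ)..t, s * (2 * c * A * Real.exp (c * s ^ 2)) := by
    refine intervalIntegral.norm_integral_le_of_norm_le ht
      (Eventually.of_forall fun s hs => ?_) (hcont.intervalIntegrable _ _)
    refine (norm_smul_cubicMean_le hA0 hc hG s).trans_eq ?_
    rw [abs_of_pos hs.1]
  rw [intervalIntegral.integral_eq_sub_of_hasDerivAt (fun s _ => hasDerivAt_exp_sq A c s)
    (hcont.intervalIntegrable _ _)] at h1
  have h2 := norm_sub_le x₀ (∫ s in (0 : ℝ)..t, s • cubicMean G s)
  simp only [ne_eq, OfNat.ofNat_ne_zero, not_false_eq_true, zero_pow, mul_zero, Real.exp_zero,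
    mul_one] at h1
  rw [response]
  linarith

theorem dist_response_le {x₀ : E} {G : ℝ → E} {A c : ℝ} (hA : 0 ≤ A) (hc : 0 ≤ c)
    (hG : ∀ s, ‖G s‖ ≤ 2 * c * A * Real.exp (c * s ^ 2)) (hGc : Continuous G) (s t : ℝ) :
    dist (response x₀ G s) (response x₀ G t) ≤
      |(∫ σ in (0 : ℝ)..s, |σ| * (2 * c * A * Real.exp (c * σ ^ 2))) -
        ∫ σ in (0 : ℝ)..t, |σ| * (2 * c * A * Real.exp (c * σ ^ 2))| := by
  have hcont : Continuous fun s => |s| * (2 * c * A * Real.exp (c * s ^ 2)) := by fun_prop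
  rw [dist_comm, dist_eq_norm, response, response, sub_sub_sub_cancel_left,
    intervalIntegral.integral_interval_sub_left (intervalIntegrable_smul_cubicMean hGc _ _)
      (intervalIntegrable_smul_cubicMean hGc _ _),
    intervalIntegral.integral_interval_sub_left (hcont.intervalIntegrable _ _)
      (hcont.intervalIntegrable _ _)]
  exact intervalIntegral.norm_integral_le_abs_of_norm_le
    (Eventually.of_forall fun σ => norm_smul_cubicMean_le hA hc hG σ) (hcont.intervalIntegrable _ _)

theorem norm_delayed_force_le {F : Type*} [NormedAddCommGroup F] {g : F → F} {C A δ : ℝ}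
    (hC : 0 ≤ C) (hA : 1 ≤ A) (hδ : 0 ≤ δ) (hg : ∀ z, ‖g z‖ ≤ C * (1 + ‖z‖)) {Y : ℝ → F}
    (hY : ∀ t, 0 ≤ t → ‖Y t‖ ≤ A * Real.exp (C * t ^ 2)) (s : ℝ) :
    ‖g (Y (max (s - δ) 0))‖ ≤ 2 * C * A * Real.exp (C * s ^ 2) := by
  have h1 : max (s - δ) 0 ^ 2 ≤ s ^ 2 := by
    rw [← sq_abs s]
    refine pow_le_pow_left₀ (le_max_right _ _) (max_le ?_ (abs_nonneg s)) 2
    linarith [le_abs_self s]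
  have h2 : ‖Y (max (s - δ) 0)‖ ≤ A * Real.exp (C * s ^ 2) :=
    (hY _ (le_max_right _ _)).trans (by gcongr)
  have h3 : 1 ≤ A * Real.exp (C * s ^ 2) :=
    one_le_mul_of_one_le_of_one_le hA (Real.one_le_exp (by positivity))
  refine (hg _).trans ?_
  nlinarith

theorem norm_delayedIterate_le {g : E → E} {x₀ : E} {C A δ : ℝ} (hC : 0 ≤ C) (hA : 1 ≤ A)
    (hx : ‖x₀‖ ≤ A) (hδ : 0 ≤ δ) (hg : ∀ z, ‖g z‖ ≤ C * (1 + ‖z‖)) (k : ℕ) :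
    ∀ t, 0 ≤ t → ‖delayedIterate g x₀ δ k t‖ ≤ A * Real.exp (C * t ^ 2) := by
  induction k with
  | zero =>
    intro t _
    exact hx.trans (le_mul_of_one_le_right (by linarith) (Real.one_le_exp (by positivity)))
  | succ k ih =>
    exact fun t ht => norm_response_le hx hC (norm_delayed_force_le hC hA hδ hg ih) ht

/-- Peano's theorem for the flow with a continuous force of linear growth, in integral form. -/
theorem exists_eq_response [ProperSpace E] {g : E → E} (hgc : Continuous g) {C : ℝ} (hC : 0 ≤ C)
    (hg : ∀ z, ‖g z‖ ≤ C * (1 + ‖z‖)) (x₀ : E) :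
    ∃ X : ℝ → E, Continuous X ∧ ∀ t, X t = response x₀ (fun s => g (X (max s 0))) t := by
  set A := 1 + ‖x₀‖ with hAdef
  have hA : 1 ≤ A := by simp [hAdef]
  have hA0 : 0 ≤ A := by linarith
  have hx : ‖x₀‖ ≤ A := by simp [hAdef]
  set δ : ℕ → ℝ := fun n => 1 / ((n : ℝ) + 1) with hδdef
  have hδ : ∀ n, 0 ≤ δ n := fun n => by positivity
  -- With delay $1/(n+1)$, this many iterations make the delayed equation exact up to time $n+1$, so
  -- each fixed time is eventually covered.
  set K : ℕ → ℕ := fun n => (n + 1) ^ 2 with hK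
  set G : ℕ → ℝ → E := fun n s => g (delayedIterate g x₀ (δ n) (K n) (max (s - δ n) 0)) with hG
  set Z : ℕ → ℝ → E := fun n => response x₀ (G n) with hZ
  have hGc : ∀ n, Continuous (G n) := fun n => by
    have := continuous_delayedIterate hgc x₀ (δ n) (K n)
    rw [hG]; fun_prop
  have hGb : ∀ n s, ‖G n s‖ ≤ 2 * C * A * Real.exp (C * s ^ 2) := fun n =>
    norm_delayed_force_le hC hA (hδ n) hg (norm_delayedIterate_le hC hA hx (hδ n) hg (K n))
  set Λ : ℝ → ℝ := fun t => ∫ σ in (0 : ℝ)..t, |σ| * (2 * C * A * Real.exp (C * σ ^ 2)) with hΛdef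
  have hΛ : Continuous Λ := by
    have hcont : Continuous fun s => |s| * (2 * C * A * Real.exp (C * s ^ 2)) := by fun_prop
    exact intervalIntegral.continuous_primitive (fun b c => hcont.intervalIntegrable b c) 0
  have hmod : ∀ n s t, dist (Z n s) (Z n t) ≤ |Λ s - Λ t| := fun n s t =>
    dist_response_le hA0 hC (hGb n) (hGc n) s t
  obtain ⟨φ, hφ, X, hX⟩ := exists_tendsto_subseq hΛ hmod fun n => response_zero x₀ (G n)
  have hXmod : ∀ s t, dist (X s) (X t) ≤ |Λ s - Λ t| := fun s t =>
    le_of_tendsto ((hX s).dist (hX t)) (Eventually.of_forall fun n => hmod _ s t)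
  have hXc : Continuous X := by
    refine continuous_iff_continuousAt.2 fun s => tendsto_iff_dist_tendsto_zero.2 ?_
    refine squeeze_zero (fun _ => dist_nonneg) (fun t => hXmod t s) ?_
    have : Continuous fun t => |Λ t - Λ s| := by fun_prop
    simpa using this.tendsto s
  refine ⟨X, hXc, fun t => tendsto_nhds_unique (hX t) ?_⟩
  refine tendsto_response (fun n => hGc (φ n)) (β := fun s => 2 * C * A * Real.exp (C * s ^ 2))
    (by fun_prop) (fun n s => hGb _ s) (fun s => ?_) t
  have hGZ : ∀ᶠ n in atTop, G (φ n) s = g (Z (φ n) (max (s - δ (φ n)) 0)) := by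
    filter_upwards [eventually_ge_atTop ⌈s⌉₊] with n hn
    have h1 : s ≤ φ n := (Nat.le_ceil s).trans (by exact_mod_cast hn.trans (hφ.id_le n))
    have h2 : (K (φ n) : ℝ) * δ (φ n) = φ n + 1 := by
      simp only [hK, hδdef]
      push_cast
      field_simp
    simp only [hG, hZ]
    rw [← delayedIterate_succ_eq g x₀ (hδ _) _ _ (le_max_right _ _)]
    · rfl
    · rw [h2]
      refine max_le ?_ (by positivity)
      linarith [hδ (φ n)]
  have hδlim : Tendsto (fun n => δ (φ n)) atTop (𝓝 0) :=
    tendsto_one_div_add_atTop_nhds_zero_nat.comp hφ.tendsto_atTop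
  have hZlim : Tendsto (fun n => Z (φ n) (max (s - δ (φ n)) 0)) atTop (𝓝 (X (max s 0))) := by
    refine tendsto_of_tendsto_of_dist (hX (max s 0)) ?_
    refine squeeze_zero (fun _ => dist_nonneg) (fun n => hmod (φ n) _ _) ?_
    have hc : Continuous fun d : ℝ => |Λ (max s 0) - Λ (max (s - d) 0)| := by fun_prop
    have := (hc.tendsto 0).comp hδlim
    simpa [Function.comp_def] using this
  exact ((hgc.tendsto _).comp hZlim).congr' (hGZ.mono fun n hn => hn.symm)

theorem hasDerivAt_smul_cubicMean [CompleteSpace E] {G : ℝ → E} (hG : Continuous G) {t : ℝ}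
    (ht : 0 < t) :
    HasDerivAt (fun s => s • cubicMean G s) (G t - (3 / t) • (t • cubicMean G t)) t := by
  have hc : Continuous fun σ : ℝ => σ ^ 3 • G σ := by fun_prop
  have h1 : HasDerivAt (fun s => ∫ σ in (0 : ℝ)..s, σ ^ 3 • G σ) (t ^ 3 • G t) t :=
    intervalIntegral.integral_hasDerivAt_right (hc.intervalIntegrable _ _)
      (hc.stronglyMeasurableAtFilter _ _) hc.continuousAt
  have h2 := ((hasDerivAt_pow 3 t).inv (pow_ne_zero 3 ht.ne')).smul h1
  have h3 : (fun s => s • cubicMean G s) =ᶠ[𝓝 t]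
      (fun s : ℝ => s ^ 3)⁻¹ • fun s => ∫ σ in (0 : ℝ)..s, σ ^ 3 • G σ := by
    filter_upwards [Ioi_mem_nhds ht] with s hs
    exact smul_cubicMean hs
  refine (h2.congr_of_eventuallyEq h3).congr_deriv ?_
  rw [smul_cubicMean ht, smul_smul, smul_smul]
  simp only [Pi.inv_apply]
  rw [inv_mul_cancel₀ (pow_ne_zero 3 ht.ne'), one_smul, sub_eq_add_neg, ← neg_smul]
  congr 2
  field_simp
  norm_num
  ring

end Existence

/-! ### Existence for the given potential -/

theorem continuous_force (ε a : ℝ) : Continuous (force ε a) := by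
  have h : Continuous fun x : Plane => (slope ‖x‖ / ‖x‖) • x := by
    refine continuous_iff_continuousAt.2 fun x => ?_
    rcases eq_or_ne x 0 with rfl | hx
    · have h1 : Tendsto (fun x : Plane => slope ‖x‖) (𝓝 0) (𝓝 0) := by
        have := (slope_continuous.comp (continuous_norm (E := Plane))).tendsto 0
        simpa [slope_of_nonpos, Function.comp_def] using this
      rw [ContinuousAt, smul_zero]
      -- Away from the origin the radial force has norm exactly `slope ‖x‖`, which tends to $0$
      -- there.
      refine squeeze_zero_norm (fun x => ?_) h1
      rw [norm_smul, Real.norm_of_nonneg (div_nonneg (slope_nonneg _) (norm_nonneg x))]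
      rcases eq_or_ne x 0 with rfl | hx
      · simp [slope_nonneg]
      · rw [div_mul_cancel₀ _ (norm_ne_zero_iff.2 hx)]
    · exact ((slope_continuous.comp continuous_norm).continuousAt.div
        continuous_norm.continuousAt (norm_ne_zero_iff.2 hx)).smul continuousAt_id
  have h2 : Continuous fun x : Plane => ε * max (x 0 - a) 0 := by fun_prop
  exact h.add (h2.smul continuous_const)

theorem norm_force_le {ε a : ℝ} (hε : 0 < ε) (ha : 0 < a) (x : Plane) :
    ‖force ε a x‖ ≤ (1 + ε) * (1 + ‖x‖) := by
  have h1 : ‖(slope ‖x‖ / ‖x‖) • x‖ ≤ 1 / 2 := by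
    rw [norm_smul, Real.norm_of_nonneg (div_nonneg (slope_nonneg _) (norm_nonneg x))]
    rcases eq_or_ne x 0 with rfl | hx
    · simp
    · rw [div_mul_cancel₀ _ (norm_ne_zero_iff.2 hx)]
      exact slope_le_half _
  have h2 : max (x 0 - a) 0 ≤ ‖x‖ := by
    have h3 := PiLp.norm_apply_le x 0
    rw [Real.norm_eq_abs] at h3
    exact max_le (by linarith [le_abs_self (x 0)]) (norm_nonneg x)
  have h3 : ‖(ε * max (x 0 - a) 0) • (EuclideanSpace.single 0 1 : Plane)‖ ≤ ε * ‖x‖ := by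
    rw [norm_smul, Real.norm_of_nonneg (by positivity)]
    simpa using mul_le_mul_of_nonneg_left h2 hε.le
  have h4 := norm_add_le_of_le h1 h3
  rw [← force] at h4
  nlinarith [norm_nonneg x]

theorem exists_isSolution {ε a : ℝ} (hε : 0 < ε) (ha : 0 < a) :
    ∃ X : ℝ → Plane, IsSolution (potential ε a) (startPoint a) X := by
  obtain ⟨X, hXc, hX⟩ := exists_eq_response (continuous_force ε a) (C := 1 + ε) (by positivity)
    (norm_force_le hε ha) (startPoint a)
  set G : ℝ → Plane := fun s => force ε a (X (max s 0)) with hGdef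
  have hG : Continuous G := by
    have := continuous_force ε a
    fun_prop
  have hXeq : X = response (startPoint a) G := funext hX
  have hd : ∀ t, HasDerivAt X (-(t • cubicMean G t)) t := fun t => by
    rw [hXeq]
    exact hasDerivAt_response _ hG t
  have hderiv : deriv X = fun t => -(t • cubicMean G t) := funext fun t => (hd t).deriv
  have hVc : Continuous fun t : ℝ => t • cubicMean G t :=
    continuous_id.smul (continuous_cubicMean hG)
  have hd2 : ∀ t, 0 < t →
      HasDerivAt (deriv X) (-(G t - (3 / t) • (t • cubicMean G t))) t := fun t ht => by
    rw [hderiv]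
    exact (hasDerivAt_smul_cubicMean hG ht).neg
  have hXd : Differentiable ℝ X := fun t => (hd t).differentiableAt
  -- The second derivative is read off from the equation, which is continuous for $t>0$ only because
  -- of the coefficient $3/t$.
  have hC2 : ContDiffOn ℝ 1 (deriv X) (Ioi 0) := by
    have h1 : (1 : WithTop ℕ∞) = 0 + 1 := by norm_num
    rw [h1, contDiffOn_succ_iff_deriv_of_isOpen isOpen_Ioi]
    refine ⟨fun t ht => (hd2 t ht).differentiableAt.differentiableWithinAt, by simp, ?_⟩
    rw [contDiffOn_zero]
    have hq : ContinuousOn (fun t : ℝ => 3 / t) (Ioi 0) :=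
      continuousOn_const.div continuousOn_id fun t ht => (mem_Ioi.1 ht).ne'
    have hc : ContinuousOn (fun t => -(G t - (3 / t) • (t • cubicMean G t))) (Ioi 0) :=
      (hG.continuousOn.sub (hq.smul hVc.continuousOn)).neg
    exact hc.congr fun t ht => (hd2 t ht).deriv
  refine ⟨X, ?_, ?_, ?_, ?_, ?_⟩
  · refine ContDiff.contDiffOn (contDiff_one_iff_deriv.2 ⟨hXd, ?_⟩)
    rw [hderiv]
    exact hVc.neg
  · have h2 : (2 : WithTop ℕ∞) = 1 + 1 := by norm_num
    rw [h2, contDiffOn_succ_iff_deriv_of_isOpen isOpen_Ioi]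
    exact ⟨hXd.differentiableOn, by simp, hC2⟩
  · rw [hXeq, response_zero]
  · rw [((hd 0).hasDerivWithinAt).derivWithin (uniqueDiffOn_Ici 0 0 self_mem_Ici)]
    simp
  · intro t ht
    rw [(hd2 t ht).deriv, (hasGradientAt_potential ε a (X t)).gradient, (hd t).deriv, hGdef]
    beta_reduce
    rw [max_eq_left ht.le, smul_neg]
    abel

end NesterovFlow

end

theorem mainTheorem2 (a : ℝ) (ha : 0 < a) :
    (∃ ε₀ : ℝ, 0 < ε₀ ∧ ∀ ε : ℝ, 0 < ε → ε < ε₀ →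
      (∃ X : ℝ → NesterovFlow.Plane,
        NesterovFlow.IsSolution (NesterovFlow.potential ε a) (NesterovFlow.startPoint a) X) ∧
      (∀ X : ℝ → NesterovFlow.Plane,
        NesterovFlow.IsSolution (NesterovFlow.potential ε a) (NesterovFlow.startPoint a) X →
        0 < NesterovFlow.angularConstant ε a X)) ∧
    (∀ ε : ℝ, 0 < ε → ∀ X : ℝ → NesterovFlow.Plane,
      NesterovFlow.IsSolution (NesterovFlow.potential ε a) (NesterovFlow.startPoint a) X →
      0 < NesterovFlow.angularConstant ε a X →
      ∃ c₀ C₀ T₀ : ℝ, 0 < c₀ ∧ 0 < C₀ ∧ 1 < T₀ ∧ ∀ t : ℝ, T₀ ≤ t →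
        c₀ / (t ^ 2 * Real.log t) ≤ NesterovFlow.potential ε a (X t) ∧
        NesterovFlow.potential ε a (X t) ≤ C₀ / t ^ 2) := by
  refine ⟨?_, fun ε hε X hX hκ => hX.planarMotion.potential_bounds ha hε hκ⟩
  obtain ⟨ε₀, hε₀, h⟩ := NesterovFlow.PlanarMotion.exists_angularConstant_pos ha
  exact ⟨ε₀, hε₀, fun ε hε hεε => ⟨NesterovFlow.exists_isSolution hε ha,
    fun X hX => h ε hε hεε _ _ _ _ _ _ hX.planarMotion⟩⟩
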